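/- **Conventions.** For an uncountable cardinal $\kappa$, $[\kappa]^\omega$ is the set of countable $x\subseteq\kappa$ such that $x\cap\omega_1$ is a countable ordinal, denoted $\delta_x$. A set $C\subseteq[\kappa]^\omega$ is club if it is cofinal under inclusion and closed under unions of increasing countable chains; $S\subseteq[\kappa]^\omega$ is stationary if it meets every club; "almost all" means "all in some club"; $S_1\equiv S_2$ means $S_1\cap C=S_2\cap C$ for some club $C$. The same notions are used for $[H_{\kappa^+}]^\omega$ (countable $M\subseteq H_{\kappa^+}$ with $\delta_M=M\cap\omega_1$ a countable ordinal), where $H_{\kappa^+}$ is the set of all sets hereditarily of cardinality $\le\kappa$, and, with the usual meaning, for subsets of $\omega_1$. An $\omega_1$-extension of $x$ is a $y\supseteq x$ with $\delta_y=\delta_x$. A set $S\subseteq[\kappa]^\omega$ is projective stationary if $\{x\in S:\delta_x\in A\}$ is stationary for every stationary $A\subseteq\omega_1$. An $\omega_1$-chain is an increasing continuous sequence $\langle x_\alpha:\alpha<\omega_1\rangle$ with $\delta_{x_\alpha}<\delta_{x_\beta}$ for $\alpha<\beta$. SRP is the statement that for every cardinal $\kappa\ge\omega_2$ every projective stationary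 $S\subseteq[\kappa]^\omega$ contains an $\omega_1$-chain (that is, all terms of the chain are in $S$). $S\subseteq[\kappa]^\omega$ is spanning above $A\subseteq\omega_1$ if for every club $C\subseteq[H_{\kappa^+}]^\omega$ there is a club $D\subseteq[H_{\kappa^+}]^\omega$ such that every $M\in D$ with $\delta_M\in A$ has an $\omega_1$-extension $N\in C$ with $N\cap\kappa\in S$. $S$ is nonstationary above $B\subseteq\omega_1$ if $\{x\in S:\delta_x\in B\}$ is nonstationary. **Theorem 6.5 (structure theorem).** Assume SRP and let $\kappa\ge\omega_2$. For every stationary $S\subseteq[\kappa]^\omega$ there is a stationary $A_S\subseteq\omega_1$ such that (i) almost all $x\in S$ have $\delta_x\in A_S$; (ii) almost all $x\in[\kappa]^\omega$ with $\delta_x\in A_S$ have an $\omega_1$-extension $y\in S$; (iii) $S$ is spanning above $A_S$ and nonstationary above $\omega_1\setminus A_S$; (iv) for every cardinal $\lambda\ge\kappa$ and every model $(\lambda,\dots)$ in a countable first-order language, almost all $M\in[\lambda]^\omega$ with $M\prec(\lambda,\dots)$ and $\delta_M\in A_S$ have an $\omega_1$-extension $N\in[\lambda]^\omega$ with $N\prec(\lambda,\dots)$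 and $N\cap\kappa\in S$. The set $A_S$ is unique modulo the club filter and invariant under equivalence of $S$, in the following sense. Say that a stationary $A\subseteq\omega_1$ is *associated with* $S$ if almost all $x\in S$ have $\delta_x\in A$ and, moreover, $S$ is spanning above $A$ or the statement in (iv) holds for $\lambda=\kappa$ with $A$ in place of $A_S$. Then every $A$ associated with $S$ satisfies $A\equiv A_S$; and if $S_1\equiv S_2$ are stationary subsets of $[\kappa]^\omega$ and $A_i$ is associated with $S_i$ for $i=1,2$, then $A_1\equiv A_2$. -/

import Mathlib

open Set Cardinal Ordinal

universe u v w

namespace StationaryStructure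

/-- The intersection `x ∩ ω₁` of a set `x` of ordinals with `ω₁`.  Once `x ∩ ω₁` is known to be an
ordinal, this set is the ordinal `δ_x` (an ordinal is the set of the smaller ordinals). -/
def trace (x : Set Ordinal.{u}) : Set Ordinal.{u} := x ∩ Iio (ω_ 1)

/-- `x ∩ ω₁` is a countable ordinal, i.e. `δ_x` is defined. -/
def HasDelta (x : Set Ordinal.{u}) : Prop := ∃ δ < (ω_ 1 : Ordinal.{u}), trace x = Iio δ

/-- `δ_x ∈ A`, for a set `A` of countable ordinals. -/
def DeltaMem (x : Set Ordinal.{u}) (A : Set (Iio (ω_ 1 : Ordinal.{u}))) : Prop :=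
  ∃ δ ∈ A, trace x = Iio (δ : Ordinal.{u})

/-- The space `[κ]^ω`: the countable subsets `x` of the cardinal `κ` (a cardinal is its initial
ordinal) for which `x ∩ ω₁` is a countable ordinal. -/
def Pω (κ : Cardinal.{u}) : Set (Set Ordinal.{u}) :=
  {x | x ⊆ Iio κ.ord ∧ x.Countable ∧ HasDelta x}

/-- `H_μ`: the sets hereditarily of cardinality less than `μ`. -/
def H (μ : Cardinal.{u}) : Set ZFSet.{u} := {a | a.Hereditarily fun b => b.card < μ}

/-- The ordinals that belong to a set `M` of sets. -/
def ordinalsOf (M : Set ZFSet.{u}) : Set Ordinal.{u} := {α | α.toZFSet ∈ M}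

/-- The space `[H_μ]^ω`: the countable subsets `M` of `H_μ` for which `M ∩ ω₁` is a countable
ordinal. -/
def PωH (μ : Cardinal.{u}) : Set (Set ZFSet.{u}) :=
  {M | M ⊆ H μ ∧ M.Countable ∧ HasDelta (ordinalsOf M)}

/-- `C` is closed unbounded in the space `P` of countable sets: cofinal with respect to inclusion
and closed under unions of increasing countable chains. -/
structure IsClubIn {α : Type v} (P C : Set (Set α)) : Prop where
  subset : C ⊆ P
  cofinal : ∀ x ∈ P, ∃ y ∈ C, x ⊆ y
  closed : ∀ f : ℕ → Set α, Monotone f → (∀ n, f n ∈ C) → (⋃ n, f n) ∈ C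

/-- `S` is a stationary subset of the space `P`. -/
def IsStationaryIn {α : Type v} (P S : Set (Set α)) : Prop :=
  S ⊆ P ∧ ∀ C, IsClubIn P C → (S ∩ C).Nonempty

/-- `S₁ ≡ S₂` modulo the club filter of the space `P`. -/
def EquivIn {α : Type v} (P S₁ S₂ : Set (Set α)) : Prop :=
  ∃ C, IsClubIn P C ∧ S₁ ∩ C = S₂ ∩ C

/-- `A ≡ B` modulo the club filter on `ω₁`. -/
def EquivModClub (A B : Set (Iio (ω_ 1 : Ordinal.{u}))) : Prop :=
  ∃ C, IsClub C ∧ A ∩ C = B ∩ C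

/-- `y` is an `ω₁`-extension of `x`: `x ⊆ y` and `δ_x = δ_y`. -/
def IsExt (x y : Set Ordinal.{u}) : Prop := x ⊆ y ∧ trace x = trace y

/-- `N` is an `ω₁`-extension of `M`, for sets of sets. -/
def IsExtH (M N : Set ZFSet.{u}) : Prop :=
  M ⊆ N ∧ trace (ordinalsOf M) = trace (ordinalsOf N)

/-- `S` is projective stationary in `[κ]^ω`. -/
def IsProjectiveStationary (κ : Cardinal.{u}) (S : Set (Set Ordinal.{u})) : Prop :=
  S ⊆ Pω κ ∧ ∀ A : Set (Iio (ω_ 1 : Ordinal.{u})), IsStationary A →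
    IsStationaryIn (Pω κ) {x ∈ S | DeltaMem x A}

/-- `S` contains an `ω₁`-chain: there is an increasing continuous sequence `⟨x_α | α < ω₁⟩` of
elements of `S` such that `δ_{x_α} < δ_{x_β}` whenever `α < β < ω₁`. -/
def ContainsChain (S : Set (Set Ordinal.{u})) : Prop :=
  ∃ x : Iio (ω_ 1 : Ordinal.{u}) → Set Ordinal.{u},
    (∀ α, x α ∈ S) ∧
    (∀ α β, α < β → x α ⊆ x β ∧ trace (x α) ⊂ trace (x β)) ∧
    (∀ γ, Order.IsSuccLimit γ → x γ = ⋃ α ∈ Iio γ, x α)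

/-- The Strong Reflection Principle: for every `κ ≥ ω₂`, every projective stationary subset of
`[κ]^ω` contains an `ω₁`-chain. -/
def SRP : Prop :=
  ∀ κ : Cardinal.{u}, ℵ_ 2 ≤ κ → ∀ S : Set (Set Ordinal.{u}),
    IsProjectiveStationary κ S → ContainsChain S

/-- For almost all `x ∈ S`, `δ_x ∈ A`. -/
def AlmostAllDeltaMem (κ : Cardinal.{u}) (S : Set (Set Ordinal.{u}))
    (A : Set (Iio (ω_ 1 : Ordinal.{u}))) : Prop :=
  ∃ C, IsClubIn (Pω κ) C ∧ ∀ x ∈ C, x ∈ S → DeltaMem x A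

/-- Almost all `x ∈ [κ]^ω` with `δ_x ∈ A` have an `ω₁`-extension `y ∈ S`. -/
def AlmostAllExt (κ : Cardinal.{u}) (S : Set (Set Ordinal.{u}))
    (A : Set (Iio (ω_ 1 : Ordinal.{u}))) : Prop :=
  ∃ C, IsClubIn (Pω κ) C ∧ ∀ x ∈ C, DeltaMem x A → ∃ y ∈ S, IsExt x y

/-- `S ⊆ [κ]^ω` is spanning above `A`: for every club `C` in `[H_{κ⁺}]^ω` there is a club `D` in
`[H_{κ⁺}]^ω` such that every `M ∈ D` with `δ_M ∈ A` has an `ω₁`-extension `N ∈ C` with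
`N ∩ κ ∈ S`. -/
def SpanningAbove (κ : Cardinal.{u}) (S : Set (Set Ordinal.{u}))
    (A : Set (Iio (ω_ 1 : Ordinal.{u}))) : Prop :=
  ∀ C, IsClubIn (PωH (Order.succ κ)) C → ∃ D, IsClubIn (PωH (Order.succ κ)) D ∧
    ∀ M ∈ D, DeltaMem (ordinalsOf M) A →
      ∃ N ∈ C, IsExtH M N ∧ ordinalsOf N ∩ Iio κ.ord ∈ S

/-- `S ⊆ [κ]^ω` is nonstationary above `B`: the set of all `x ∈ S` with `δ_x ∈ B` is
nonstationary. -/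
def NonstationaryAbove (κ : Cardinal.{u}) (S : Set (Set Ordinal.{u}))
    (B : Set (Iio (ω_ 1 : Ordinal.{u}))) : Prop :=
  ¬ IsStationaryIn (Pω κ) {x ∈ S | DeltaMem x B}

/-- `M` is the universe of an elementary submodel of the given model `(E, …)`. -/
def IsElemSubmodel (L : FirstOrder.Language.{v, w}) {E : Set Ordinal.{u}} [L.Structure E]
    (M : Set Ordinal.{u}) : Prop :=
  ∃ N : L.ElementarySubstructure E, M = (↑) '' (N : Set E)

/-- For every model `(μ, …)` with universe the cardinal `μ`, in a countable first-order language,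
almost all countable `M ≺ (μ, …)` with `δ_M ∈ A` have a (countable) `ω₁`-extension
`N ≺ (μ, …)` such that `N ∩ κ ∈ S`. -/
def ModelExt (κ μ : Cardinal.{u}) (S : Set (Set Ordinal.{u}))
    (A : Set (Iio (ω_ 1 : Ordinal.{u}))) : Prop :=
  ∀ (L : FirstOrder.Language.{v, w}) [Countable L.Symbols] [L.Structure (Iio μ.ord)],
    ∃ D, IsClubIn (Pω μ) D ∧
      ∀ M ∈ D, IsElemSubmodel L (E := Iio μ.ord) M → DeltaMem M A →
        ∃ N ∈ Pω μ, IsElemSubmodel L (E := Iio μ.ord) N ∧ IsExt M N ∧ N ∩ Iio κ.ord ∈ S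

/-- `A` is a set of the kind associated with `S`: `A` is a stationary subset of `ω₁`, almost all
`x ∈ S` have `δ_x ∈ A`, and `S` is spanning above `A` in one of two senses: through clubs of
`[H_{κ⁺}]^ω`, or through countable elementary submodels of the models `(κ, …)`. -/
def IsStructureSet (κ : Cardinal.{u}) (S : Set (Set Ordinal.{u}))
    (A : Set (Iio (ω_ 1 : Ordinal.{u}))) : Prop :=
  IsStationary A ∧ AlmostAllDeltaMem κ S A ∧ (SpanningAbove κ S A ∨ ModelExt.{u, v, w} κ κ S A)

end StationaryStructure

namespace StationaryStructure

/-! Everything follows from one set A: `S` is stationary above every stationary B ⊆ A (the x ∈ `S`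
with δ_x ∈ B form a stationary set) and nonstationary above the complement of A.

`SRP.exists_isStationary` finds A. Every stationary set of countable ordinals contains a stationary
B that either has `S` nonstationary above it or has `S` stationary above all its stationary subsets.
Code the subsets of ω₁ by ordinals below 2^ℵ₁. The countable x that contain a code of such a B with
δ_x ∈ B form a projective stationary set, and SRP gives an ω₁-chain of them. The chain mentions only
ℵ₁ codes, so A can be taken as the diagonal union of the sets B of the second kind coded along the
chain; diagonal intersections dispose of those of the first kind.

`SRP.exists_extension` turns stationarity above A into ω₁-extensions. Suppose that stationarily many
x above A have no extension in G. By the previous step these x are projective stationary above some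
A'; adding all x with δ_x ∉ A' gives a projective stationary set, hence a chain. A member of G above
A ∩ A' that is closed enough contains the chain term with the same δ, and so extends it: a
contradiction. Applied over κ, over H_{κ⁺} and over λ, with `isStationaryIn_lift` moving `S` to the
larger base, this gives (ii), (iii) and (iv).

Uniqueness uses no SRP: if A₁ \ A₂ were stationary, spanning above A₁ would put members of `S` above
A₁ \ A₂ into every club. Clubs are handled throughout as closure under set-valued functions, by
Kueker's theorem. -/

/-- The set of countable ordinals, as a linearly ordered type. -/
abbrev Omega1 : Type (u + 1) := ↥(Iio (ω_ 1 : Ordinal.{u}))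

/-! ### Closed unbounded sets of countable ordinals -/

theorem mk_omega1 : #Omega1.{u} = ℵ₁ := by
  simp [Cardinal.mk_Iio_ordinal]

theorem cof_omega1 : Order.cof Omega1.{u} = ℵ₁ := by
  rw [Ordinal.cof_Iio, ← Ordinal.lift_cof, Cardinal.cof_omega_one]
  simp

theorem cof_omega1_ne : Order.cof Omega1.{u} ≠ ℵ₀ := by
  rw [cof_omega1]
  exact Cardinal.aleph0_lt_aleph_one.ne'

theorem omega1_pos : (0 : Ordinal.{u}) < ω_ 1 := Ordinal.omega_pos 1

instance : Nonempty Omega1.{u} := ⟨⟨0, omega1_pos⟩⟩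

theorem countable_Iio_of_lt {a : Ordinal.{u}} (ha : a < ω_ 1) : (Iio a).Countable := by
  rw [← Cardinal.le_aleph0_iff_set_countable, Cardinal.mk_Iio_ordinal, Cardinal.lift_le_aleph0,
    ← Cardinal.lt_aleph_one_iff]
  rw [← Cardinal.ord_aleph] at ha
  exact Cardinal.lt_ord.1 ha

theorem Omega1.countable_Iio (a : Omega1.{u}) : (Iio a).Countable :=
  (countable_Iio_of_lt a.2).preimage (f := ((↑) : Omega1.{u} → Ordinal.{u}))
    Subtype.val_injective

theorem Omega1.countable_Iic (a : Omega1.{u}) : (Iic a).Countable := by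
  rw [← Iio_union_right]
  exact (Omega1.countable_Iio a).union (countable_singleton a)

theorem Omega1.exists_gt_of_countable {s : Set Omega1.{u}} (hs : s.Countable) :
    ∃ b, ∀ a ∈ s, a < b := by
  have : ¬ IsCofinal s := fun h => by
    have h1 := Order.cof_le h
    rw [cof_omega1] at h1
    exact (Cardinal.aleph0_lt_aleph_one.trans_le h1).not_ge
      (Cardinal.le_aleph0_iff_set_countable.2 hs)
  obtain ⟨b, hb⟩ := not_isCofinal_iff.1 this
  exact ⟨b, hb⟩

theorem Omega1.exists_gt (a : Omega1.{u}) : ∃ b, a < b := by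
  obtain ⟨b, hb⟩ := exists_gt_of_countable (countable_singleton a)
  exact ⟨b, hb a rfl⟩

theorem Omega1.exists_isLUB {s : Set Omega1.{u}} (hs : s.Countable) : ∃ b, IsLUB s b := by
  obtain ⟨b, hb⟩ := exists_gt_of_countable hs
  obtain ⟨m, hm, hmin⟩ := WellFounded.has_min (wellFounded_lt (α := Omega1.{u})) (upperBounds s)
    ⟨b, fun a ha => (hb a ha).le⟩
  exact ⟨m, hm, fun c hc => not_lt.1 (hmin c hc)⟩

theorem isClub_Ioi (a : Omega1.{u}) : IsClub (Ioi a) := by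
  refine ⟨fun s hs hne _ b hb => ?_, fun b => ?_⟩
  · obtain ⟨c, hc⟩ := hne
    exact lt_of_lt_of_le (hs hc) (hb.1 hc)
  · obtain ⟨c, hc⟩ := Omega1.exists_gt (max a b)
    exact ⟨c, (le_max_left _ _).trans_lt hc, ((le_max_right _ _).trans_lt hc).le⟩

/-- The diagonal intersection of closed unbounded sets is closed unbounded. -/
theorem isClub_diagonal {C : Omega1.{u} → Set Omega1.{u}} (hC : ∀ ξ, IsClub (C ξ)) :
    IsClub {α | ∀ ξ < α, α ∈ C ξ} := by
  refine ⟨fun s hs hne _ b hb ξ hξ => ?_, fun a => ?_⟩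
  · obtain ⟨c, hc, hξc⟩ : ∃ c ∈ s, ξ < c := by
      by_contra! h
      exact hξ.not_ge (hb.2 h)
    -- Only the elements of s above ξ are known to lie in C ξ; this tail has the same supremum.
    refine (hC ξ).isLUB_mem (t := s ∩ Ici c) (fun x hx => hs hx.1 ξ (hξc.trans_le hx.2))
      ⟨c, hc, self_mem_Ici⟩ ⟨fun x hx => hb.1 hx.1, fun x hx => hb.2 fun y hy => ?_⟩
    rcases le_total c y with h | h
    · exact hx ⟨hy, h⟩
    · exact h.trans (hx ⟨hc, self_mem_Ici⟩)
  · have step : ∀ b : Omega1.{u}, ∃ c, b < c ∧ ∀ ξ ≤ b, c ∈ C ξ := by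
      intro b
      have : Countable (Iic b) := (Omega1.countable_Iic b).to_subtype
      have h1 : IsClub (⋂ ξ : Iic b, C ξ) :=
        IsClub.iInter_of_countable cof_omega1_ne fun ξ => hC ξ
      obtain ⟨b', hb'⟩ := Omega1.exists_gt b
      obtain ⟨c, hc, hbc⟩ := h1.isCofinal b'
      exact ⟨c, hb'.trans_le hbc, fun ξ hξ => mem_iInter.1 hc ⟨ξ, hξ⟩⟩
    choose g hg hgC using step
    let f : ℕ → Omega1.{u} := fun n => g^[n] a
    have hf : ∀ n, f (n + 1) = g (f n) := fun n => Function.iterate_succ_apply' g n a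
    have hmono : StrictMono f := strictMono_nat_of_lt_succ fun n => by rw [hf]; exact hg _
    obtain ⟨b, hb⟩ := Omega1.exists_isLUB (countable_range f)
    refine ⟨b, fun ξ hξ => ?_, hb.1 ⟨0, rfl⟩⟩
    obtain ⟨n, hn⟩ : ∃ n, ξ < f n := by
      by_contra! h
      exact hξ.not_ge (hb.2 (by rintro _ ⟨n, rfl⟩; exact h n))
    -- The shift by one: f (k + 1) = g (f k) lies in C η for all η ≤ f k, and ξ < f n.
    refine (hC ξ).isLUB_mem (t := range fun m => f (n + m + 1)) ?_ (range_nonempty _) ⟨?_, ?_⟩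
    · rintro _ ⟨m, rfl⟩
      simp only [hf]
      exact hgC _ _ (hn.le.trans (hmono.monotone (Nat.le_add_right n m)))
    · rintro _ ⟨m, rfl⟩
      exact hb.1 ⟨_, rfl⟩
    · intro x hx
      refine hb.2 ?_
      rintro _ ⟨m, rfl⟩
      exact (hmono.monotone (by omega)).trans (hx ⟨m, rfl⟩)

theorem isClub_closed_under (g : Omega1.{u} → Omega1.{u}) :
    IsClub {α | ∀ ξ < α, g ξ < α} :=
  isClub_diagonal fun ξ => isClub_Ioi (g ξ)

/-! ### Spaces of countable sets over an arbitrary base -/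

section

variable {α : Type v} {d : Ordinal.{u} → α} {X : Set α}

/-- The space of the countable subsets `x` of `X` such that the ordinals below `ω₁` coded in `x`
by means of `d` form a countable ordinal. -/
def Space (d : Ordinal.{u} → α) (X : Set α) : Set (Set α) :=
  {x | x ⊆ X ∧ x.Countable ∧ HasDelta (d ⁻¹' x)}

theorem Pω_eq_space (κ : Cardinal.{u}) : Pω κ = Space id (Iio κ.ord) := rfl

/-! ### Closure under set-valued functions -/

/-- `x` is closed under the set-valued function `F` of finite sets. -/
def ClosedUnder (F : Finset α → Set α) (x : Set α) : Prop :=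
  ∀ e : Finset α, ↑e ⊆ x → F e ⊆ x

/-- The values of `F` are countable subsets of `X`. -/
def CountableIn (X : Set α) (F : Finset α → Set α) : Prop :=
  ∀ e, F e ⊆ X ∧ (F e).Countable

theorem CountableIn.union {F G : Finset α → Set α} (hF : CountableIn X F) (hG : CountableIn X G) :
    CountableIn X fun e => F e ∪ G e := fun e =>
  ⟨union_subset (hF e).1 (hG e).1, (hF e).2.union (hG e).2⟩

theorem closedUnder_union_iff {F G : Finset α → Set α} {x : Set α} :
    ClosedUnder (fun e => F e ∪ G e) x ↔ ClosedUnder F x ∧ ClosedUnder G x := by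
  simp only [ClosedUnder, union_subset_iff]
  exact ⟨fun h => ⟨fun e he => (h e he).1, fun e he => (h e he).2⟩,
    fun h e he => ⟨h.1 e he, h.2 e he⟩⟩

theorem closedUnder_iUnion {ι : Type*} [Nonempty ι] {F : Finset α → Set α} {f : ι → Set α}
    (hf : Directed (· ⊆ ·) f) (h : ∀ i, ClosedUnder F (f i)) : ClosedUnder F (⋃ i, f i) := by
  intro e he
  obtain ⟨i, hi⟩ := Directed.exists_mem_subset_of_finset_subset_biUnion hf he
  exact (h i e hi).trans (subset_iUnion f i)

/-- One step of the closure under `F`. -/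
def clStep (F : Finset α → Set α) (x : Set α) : Set α :=
  x ∪ ⋃ e ∈ {e : Finset α | ↑e ⊆ x}, F e

/-- The closure of `x` under `F`. -/
def cl (F : Finset α → Set α) (x : Set α) : Set α := ⋃ n : ℕ, (clStep F)^[n] x

theorem monotone_clStep_iterate (F : Finset α → Set α) (x : Set α) :
    Monotone fun n : ℕ => (clStep F)^[n] x :=
  monotone_nat_of_le_succ fun n => by
    rw [Function.iterate_succ_apply']
    exact subset_union_left

theorem subset_cl (F : Finset α → Set α) (x : Set α) : x ⊆ cl F x :=
  subset_iUnion (fun n : ℕ => (clStep F)^[n] x) 0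

theorem closedUnder_cl (F : Finset α → Set α) (x : Set α) : ClosedUnder F (cl F x) := by
  intro e he
  obtain ⟨n, hn⟩ := Directed.exists_mem_subset_of_finset_subset_biUnion
    (monotone_clStep_iterate F x).directed_le he
  refine Subset.trans ?_ (subset_iUnion (fun n : ℕ => (clStep F)^[n] x) (n + 1))
  simp only [Function.iterate_succ_apply']
  exact subset_union_of_subset_right (subset_biUnion_of_mem (u := F) hn) _

theorem cl_subset {F : Finset α → Set α} {x y : Set α} (hxy : x ⊆ y) (hy : ClosedUnder F y) :
    cl F x ⊆ y := by
  refine iUnion_subset fun n => ?_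
  induction n with
  | zero => exact hxy
  | succ n ih =>
    rw [Function.iterate_succ_apply']
    exact union_subset ih (iUnion₂_subset fun e he => hy e (Subset.trans he ih))

theorem cl_mono {F : Finset α → Set α} {x y : Set α} (hxy : x ⊆ y) : cl F x ⊆ cl F y :=
  cl_subset (hxy.trans (subset_cl F y)) (closedUnder_cl F y)

theorem countable_setOf_finset_subset {x : Set α} (hx : x.Countable) :
    {e : Finset α | ↑e ⊆ x}.Countable := by
  classical
  refine ((countable_ofPred_finite_subset hx).preimage
    (f := ((↑) : Finset α → Set α)) Finset.coe_injective).mono ?_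
  intro e he
  exact ⟨e.finite_toSet, he⟩

theorem countable_cl {F : Finset α → Set α} (hF : ∀ e, (F e).Countable) {x : Set α}
    (hx : x.Countable) : (cl F x).Countable := by
  refine countable_iUnion fun n => ?_
  induction n with
  | zero => exact hx
  | succ n ih =>
    rw [Function.iterate_succ_apply']
    exact ih.union ((countable_setOf_finset_subset ih).biUnion fun e _ => hF e)

theorem CountableIn.closedUnder {F : Finset α → Set α} (hF : CountableIn X F) :
    ClosedUnder F X := fun e _ => (hF e).1

/-- The closures of the finite subsets of x form a directed family, so their union is already closed
under F. -/
theorem exists_finset_of_mem_cl {F : Finset α → Set α} {x : Set α} {a : α} (ha : a ∈ cl F x) :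
    ∃ e : Finset α, ↑e ⊆ x ∧ a ∈ cl F ↑e := by
  classical
  have : Nonempty {e : Finset α // ↑e ⊆ x} := ⟨⟨∅, by simp⟩⟩
  have h : cl F x ⊆ ⋃ e : {e : Finset α // ↑e ⊆ x}, cl F ↑e.1 := by
    refine cl_subset (fun b hb => ?_) (closedUnder_iUnion ?_ fun e => closedUnder_cl F _)
    · exact mem_iUnion.2 ⟨⟨{b}, by simpa using hb⟩, subset_cl F _ (by simp)⟩
    · intro e e'
      refine ⟨⟨e.1 ∪ e'.1, by simpa using ⟨e.2, e'.2⟩⟩, cl_mono ?_, cl_mono ?_⟩ <;> simp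
  obtain ⟨e, he⟩ := mem_iUnion.1 (h ha)
  exact ⟨e.1, e.2, he⟩

/-! ### The ordinal `δ_x` -/

/-- A countable y omits some countable ordinal, and the least one omitted serves as δ. Having a δ
thus becomes a closure property, which directed unions preserve. -/
theorem hasDelta_iff {y : Set Ordinal.{u}} (hy : y.Countable) :
    HasDelta y ↔ ∀ ξ ∈ y, ξ < ω_ 1 → ∀ η < ξ, η ∈ y := by
  constructor
  · rintro ⟨δ, hδ, h⟩ ξ hξ hξ1 η hη
    have h1 : ξ ∈ trace y := ⟨hξ, hξ1⟩
    rw [h] at h1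
    have h2 : η ∈ trace y := h ▸ (hη.trans h1 : η < δ)
    exact h2.1
  · intro h
    have hne : ∃ η < (ω_ 1 : Ordinal.{u}), η ∉ y := by
      by_contra! hc
      have h1 : (Iio (ω_ 1 : Ordinal.{u})).Countable := hy.mono fun a ha => hc a ha
      have h2 := Cardinal.le_aleph0_iff_set_countable.2 h1
      rw [mk_omega1] at h2
      exact h2.not_gt Cardinal.aleph0_lt_aleph_one
    obtain ⟨η₀, hη₀, hη₀y⟩ := hne
    obtain ⟨δ, hδ, hmin⟩ := WellFounded.has_min (wellFounded_lt (α := Ordinal.{u})) yᶜ ⟨η₀, hη₀y⟩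
    have hlt : δ < ω_ 1 := (not_lt.1 (hmin η₀ hη₀y)).trans_lt hη₀
    refine ⟨δ, hlt, Subset.antisymm ?_ ?_⟩
    · rintro ξ ⟨hξ, hξ1⟩
      by_contra hc
      rcases (not_lt.1 (show ¬ ξ < δ from hc)).lt_or_eq with h1 | h1
      · exact hδ (h ξ hξ hξ1 δ h1)
      · exact hδ (h1 ▸ hξ)
    · intro ξ hξ
      exact ⟨by_contra fun hc => hmin ξ hc hξ, hξ.trans hlt⟩

/-- `δ_y = δ`. -/
def IsDelta (y : Set Ordinal.{u}) (δ : Omega1.{u}) : Prop := trace y = Iio δ.1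

theorem isDelta_iff {y : Set Ordinal.{u}} {δ : Omega1.{u}} :
    IsDelta y δ ↔ ∀ ξ : Omega1.{u}, ξ.1 ∈ y ↔ ξ < δ := by
  constructor
  · intro h ξ
    have : ξ.1 ∈ trace y ↔ ξ.1 ∈ Iio δ.1 := by rw [h]
    exact ⟨fun hξ => this.1 ⟨hξ, ξ.2⟩, fun hξ => (this.2 hξ).1⟩
  · intro h
    ext ξ
    constructor
    · rintro ⟨h1, h2⟩
      exact (h ⟨ξ, h2⟩).1 h1
    · intro hξ
      have h2 : ξ < ω_ 1 := lt_trans hξ δ.2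
      exact ⟨(h ⟨ξ, h2⟩).2 hξ, h2⟩

theorem IsDelta.unique {y : Set Ordinal.{u}} {δ δ' : Omega1.{u}} (h : IsDelta y δ)
    (h' : IsDelta y δ') : δ = δ' := by
  have : Iio δ.1 = Iio δ'.1 := h.symm.trans h'
  exact Subtype.ext (Iio_injective this)

theorem HasDelta.exists_isDelta {y : Set Ordinal.{u}} (h : HasDelta y) : ∃ δ, IsDelta y δ := by
  obtain ⟨δ, hδ, h⟩ := h
  exact ⟨⟨δ, hδ⟩, h⟩

theorem IsDelta.hasDelta {y : Set Ordinal.{u}} {δ : Omega1.{u}} (h : IsDelta y δ) : HasDelta y :=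
  ⟨δ.1, δ.2, h⟩

theorem IsDelta.deltaMem_iff {y : Set Ordinal.{u}} {δ : Omega1.{u}} (h : IsDelta y δ)
    {A : Set Omega1.{u}} : DeltaMem y A ↔ δ ∈ A := by
  constructor
  · rintro ⟨δ', hδ', h'⟩
    exact h.unique (δ' := δ') h' ▸ hδ'
  · exact fun hδ => ⟨δ, hδ, h⟩

theorem DeltaMem.mono {y : Set Ordinal.{u}} {A B : Set Omega1.{u}} (h : DeltaMem y A)
    (hAB : A ⊆ B) : DeltaMem y B := by
  obtain ⟨δ, hδ, h⟩ := h
  exact ⟨δ, hAB hδ, h⟩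

/-! ### Closed unbounded sets and closure under functions -/

/-- The function whose closed sets code initial segments of `ω₁`. -/
def down (d : Ordinal.{u} → α) (e : Finset α) : Set α :=
  {a | ∃ ξ < (ω_ 1 : Ordinal.{u}), d ξ ∈ e ∧ ∃ η < ξ, a = d η}

theorem countableIn_down (hd : d.Injective) (hX : ∀ ξ < ω_ 1, d ξ ∈ X) :
    CountableIn X (down d) := by
  intro e
  constructor
  · rintro a ⟨ξ, hξ, -, η, hη, rfl⟩
    exact hX η (hη.trans hξ)
  · have h : (⋃ ξ ∈ {ξ : Ordinal.{u} | ξ < ω_ 1 ∧ d ξ ∈ e}, d '' Iio ξ).Countable := by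
      refine Countable.biUnion ?_ fun ξ hξ => (countable_Iio_of_lt hξ.1).image d
      exact ((e.countable_toSet).preimage hd).mono fun ξ hξ => hξ.2
    refine h.mono ?_
    rintro a ⟨ξ, hξ, hξe, η, hη, rfl⟩
    exact mem_biUnion (x := ξ) ⟨hξ, hξe⟩ ⟨η, hη, rfl⟩

theorem mem_space_of_closedUnder_down (hd : d.Injective) {x : Set α} (hx : x ⊆ X)
    (hc : x.Countable) (h : ClosedUnder (down d) x) : x ∈ Space d X := by
  refine ⟨hx, hc, (hasDelta_iff (hc.preimage hd)).2 fun ξ hξ hξ1 η hη => ?_⟩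
  refine h {d ξ} ?_ ⟨ξ, hξ1, by simp, η, hη, rfl⟩
  simpa using hξ

theorem closedUnder_down_of_mem_space (hd : d.Injective) {x : Set α} (hx : x ∈ Space d X) :
    ClosedUnder (down d) x := by
  rintro e he a ⟨ξ, hξ, hξe, η, hη, rfl⟩
  exact (hasDelta_iff (hx.2.1.preimage hd)).1 hx.2.2 ξ (he hξe) hξ η hη

theorem iUnion_mem_space (hd : d.Injective) {ι : Type*} [Nonempty ι] [Countable ι]
    {f : ι → Set α} (hf : Directed (· ⊆ ·) f) (h : ∀ i, f i ∈ Space d X) :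
    (⋃ i, f i) ∈ Space d X :=
  mem_space_of_closedUnder_down hd (iUnion_subset fun i => (h i).1)
    (countable_iUnion fun i => (h i).2.1)
    (closedUnder_iUnion hf fun i => closedUnder_down_of_mem_space hd (h i))

/-- The closure under `F` and `down d` of a countable set belongs to the space. -/
theorem exists_closedUnder_superset (hd : d.Injective) (hX : ∀ ξ < ω_ 1, d ξ ∈ X)
    {F : Finset α → Set α} (hF : CountableIn X F) {x : Set α} (hx : x ⊆ X) (hc : x.Countable) :
    ∃ y ∈ Space d X, x ⊆ y ∧ ClosedUnder F y := by
  have hG := hF.union (countableIn_down hd hX)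
  have h := closedUnder_union_iff.1 (closedUnder_cl (fun e => F e ∪ down d e) x)
  exact ⟨_, mem_space_of_closedUnder_down hd (cl_subset hx hG.closedUnder)
    (countable_cl (fun e => (hG e).2) hc) h.2, subset_cl _ _, h.1⟩

theorem isClubIn_closedUnder (hd : d.Injective) (hX : ∀ ξ < ω_ 1, d ξ ∈ X)
    {F : Finset α → Set α} (hF : CountableIn X F) :
    IsClubIn (Space d X) {x ∈ Space d X | ClosedUnder F x} where
  subset := sep_subset _ _
  cofinal x hx := by
    obtain ⟨y, hy, hxy, h⟩ := exists_closedUnder_superset hd hX hF hx.1 hx.2.1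
    exact ⟨y, ⟨hy, h⟩, hxy⟩
  closed f hf h := ⟨iUnion_mem_space hd hf.directed_le fun n => (h n).1,
    closedUnder_iUnion hf.directed_le fun n => (h n).2⟩

theorem countableIn_empty : CountableIn X fun _ => (∅ : Set α) := fun _ =>
  ⟨empty_subset _, countable_empty⟩

/-- **Kueker's theorem**: a closed unbounded set contains all members of the space that are closed
under a suitable function. -/
theorem IsClubIn.exists_closedUnder (hd : d.Injective) (hX : ∀ ξ < ω_ 1, d ξ ∈ X)
    {C : Set (Set α)} (hC : IsClubIn (Space d X) C) :
    ∃ F, CountableIn X F ∧ ∀ x ∈ Space d X, ClosedUnder F x → x ∈ C := by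
  classical
  have hcof : ∀ z : Set α, ∃ y ∈ C, z ⊆ X → z.Countable → z ⊆ y := by
    intro z
    by_cases hz : z ⊆ X ∧ z.Countable
    · obtain ⟨y, hy, hzy, -⟩ := exists_closedUnder_superset hd hX countableIn_empty hz.1 hz.2
      obtain ⟨y', hy', h⟩ := hC.cofinal y hy
      exact ⟨y', hy', fun _ _ => hzy.trans h⟩
    · obtain ⟨y, hy, -⟩ := exists_closedUnder_superset hd hX countableIn_empty
        (empty_subset X) countable_empty
      obtain ⟨y', hy', -⟩ := hC.cofinal y hy
      exact ⟨y', hy', fun h1 h2 => absurd ⟨h1, h2⟩ hz⟩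
  choose c hcC hc using hcof
  have hsp : ∀ z, c z ⊆ X ∧ (c z).Countable := fun z =>
    ⟨(hC.subset (hcC z)).1, (hC.subset (hcC z)).2.1⟩
  -- Each stage feeds the values at all subsets of e back into c. The union over the stages is then
  -- monotone in e and, as an increasing union, has its values in C.
  let f : ℕ → Finset α → Set α := fun n =>
    Nat.rec (fun e => c ↑e) (fun _ g e => c (⋃ e' ∈ e.powerset, g e')) n
  have hf : ∀ n e, f (n + 1) e = c (⋃ e' ∈ e.powerset, f n e') := fun n e => rfl
  have hfC : ∀ n e, f n e ∈ C := by
    intro n e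
    cases n with
    | zero => exact hcC _
    | succ n => exact hcC _
  have hsub : ∀ n e e', e' ⊆ e → f n e' ⊆ f (n + 1) e := by
    intro n e e' he
    rw [hf]
    refine Subset.trans ?_ (hc _ (iUnion₂_subset fun e'' _ => (hC.subset (hfC n e'')).1) ?_)
    · exact subset_biUnion_of_mem (u := f n) (Finset.mem_coe.2 (Finset.mem_powerset.2 he))
    · exact (Finset.countable_toSet _).biUnion fun e'' _ => (hC.subset (hfC n e'')).2.1
  let F : Finset α → Set α := fun e => ⋃ n, f n e
  have hFC : ∀ e, F e ∈ C := fun e =>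
    hC.closed _ (monotone_nat_of_le_succ fun n => hsub n e e subset_rfl) fun n => hfC n e
  have hFmono : ∀ e e', e' ⊆ e → F e' ⊆ F e := fun e e' he =>
    iUnion_subset fun n => (hsub n e e' he).trans (subset_iUnion (fun n => f n e) (n + 1))
  have hFe : ∀ e : Finset α, ↑e ⊆ X → ↑e ⊆ F e := fun e he =>
    (hc _ he e.countable_toSet).trans (subset_iUnion (fun n => f n e) 0)
  refine ⟨F, fun e => ⟨(hC.subset (hFC e)).1, (hC.subset (hFC e)).2.1⟩, fun x hx hxF => ?_⟩
  rcases x.eq_empty_or_nonempty with rfl | hne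
  · have : F ∅ = ∅ := subset_eq_empty (hxF ∅ (by simp)) rfl
    exact this ▸ hFC ∅
  · obtain ⟨a, ha⟩ := hx.2.1.exists_eq_range hne
    let e : ℕ → Finset α := fun n => (Finset.range n).image a
    have he : Monotone e := fun m n h => Finset.image_subset_image (Finset.range_mono h)
    have hex : ∀ n, ↑(e n) ⊆ x := by
      intro n b hb
      obtain ⟨i, -, rfl⟩ := Finset.mem_image.1 hb
      exact ha ▸ mem_range_self i
    have : x = ⋃ n, F (e n) := by
      refine Subset.antisymm (fun b hb => ?_) (iUnion_subset fun n => hxF _ (hex n))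
      obtain ⟨i, rfl⟩ : b ∈ range a := ha ▸ hb
      exact mem_iUnion.2 ⟨i + 1, hFe _ ((hex _).trans hx.1)
        (Finset.mem_image.2 ⟨i, Finset.mem_range.2 (Nat.lt_succ_self i), rfl⟩)⟩
    rw [this]
    exact hC.closed _ (fun m n h => hFmono _ _ (he h)) fun n => hFC _

/-- Stationarity in terms of functions. -/
theorem isStationaryIn_iff (hd : d.Injective) (hX : ∀ ξ < ω_ 1, d ξ ∈ X) {S : Set (Set α)} :
    IsStationaryIn (Space d X) S ↔
      S ⊆ Space d X ∧ ∀ F, CountableIn X F → ∃ x ∈ S, ClosedUnder F x := by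
  refine and_congr_right fun hS => ⟨fun h F hF => ?_, fun h C hC => ?_⟩
  · obtain ⟨x, hx, hxF⟩ := h _ (isClubIn_closedUnder hd hX hF)
    exact ⟨x, hx, hxF.2⟩
  · obtain ⟨F, hF, hFC⟩ := hC.exists_closedUnder hd hX
    obtain ⟨x, hx, hxF⟩ := h F hF
    exact ⟨x, hx, hFC x (hS hx) hxF⟩

theorem exists_of_not_isStationaryIn (hd : d.Injective) (hX : ∀ ξ < ω_ 1, d ξ ∈ X)
    {S : Set (Set α)} (hS : S ⊆ Space d X) (h : ¬ IsStationaryIn (Space d X) S) :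
    ∃ F, CountableIn X F ∧ ∀ x ∈ S, ¬ ClosedUnder F x := by
  rw [isStationaryIn_iff hd hX] at h
  push Not at h
  exact h hS

end

/-! ### Diagonal intersections, restriction to sets of δ, and lifting -/

section

variable {α : Type v} {d : Ordinal.{u} → α} {X : Set α}

/-- The members `x` of `S` with `δ_x ∈ B`. -/
def restr (d : Ordinal.{u} → α) (S : Set (Set α)) (B : Set Omega1.{u}) : Set (Set α) :=
  {x ∈ S | DeltaMem (d ⁻¹' x) B}

theorem restr_subset (S : Set (Set α)) (B : Set Omega1.{u}) : restr d S B ⊆ S := sep_subset _ _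

theorem restr_mono (S : Set (Set α)) {A B : Set Omega1.{u}} (h : A ⊆ B) :
    restr d S A ⊆ restr d S B := fun _ hx => ⟨hx.1, hx.2.mono h⟩

theorem IsStationaryIn.mono {P S T : Set (Set α)} (hS : IsStationaryIn P S) (h : S ⊆ T)
    (hT : T ⊆ P) : IsStationaryIn P T :=
  ⟨hT, fun C hC => (hS.2 C hC).mono (inter_subset_inter_left C h)⟩

theorem exists_forall_closedUnder {ι : Type*} [Countable ι] {G : ι → Finset α → Set α}
    (hG : ∀ i, CountableIn X (G i)) :
    ∃ F, CountableIn X F ∧ ∀ x, ClosedUnder F x → ∀ i, ClosedUnder (G i) x :=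
  ⟨fun e => ⋃ i, G i e, fun e => ⟨iUnion_subset fun i => (hG i e).1,
    countable_iUnion fun i => (hG i e).2⟩,
    fun _ hx i e he => (subset_iUnion (fun i => G i e) i).trans (hx e he)⟩

/-- Diagonal intersections of closed unbounded sets, in terms of functions. -/
theorem exists_closedUnder_diagonal (hd : d.Injective) {G : Omega1.{u} → Finset α → Set α}
    (hG : ∀ ξ, CountableIn X (G ξ)) :
    ∃ F, CountableIn X F ∧ ∀ x, ClosedUnder F x → ∀ ξ : Omega1.{u}, d ξ ∈ x →
      ClosedUnder (G ξ) x := by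
  classical
  -- The index ξ is passed inside the argument as the point d ξ; running over all subsets of the
  -- argument recovers the e to which d ξ was added.
  refine ⟨fun e => ⋃ ξ ∈ {ξ : Omega1.{u} | d ξ ∈ e}, ⋃ e' ∈ e.powerset, G ξ e', fun e => ⟨?_, ?_⟩,
    fun x hx ξ hξ e he => ?_⟩
  · exact iUnion₂_subset fun ξ _ => iUnion₂_subset fun e' _ => (hG ξ e').1
  · refine Countable.biUnion ?_ fun ξ _ =>
      (Finset.countable_toSet e.powerset).biUnion fun e' _ => (hG ξ e').2
    exact e.countable_toSet.preimage (f := fun ξ : Omega1.{u} => d ξ)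
      (hd.comp Subtype.val_injective)
  · have h := hx (insert (d ξ) e) (by
      rw [Finset.coe_insert]
      exact insert_subset hξ he)
    intro a ha
    exact h (mem_iUnion₂.2 ⟨ξ, Finset.mem_insert_self _ _, mem_iUnion₂.2
      ⟨e, Finset.mem_powerset.2 (Finset.subset_insert _ _), ha⟩⟩)

/-- Almost all members of the space have `δ_x` in a given closed unbounded set. -/
theorem exists_forall_deltaMem_of_isClub (hd : d.Injective) (hX : ∀ ξ < ω_ 1, d ξ ∈ X)
    {E : Set Omega1.{u}} (hE : IsClub E) :
    ∃ F, CountableIn X F ∧ ∀ x ∈ Space d X, ClosedUnder F x → DeltaMem (d ⁻¹' x) E := by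
  have hex : ∀ ξ : Omega1.{u}, ∃ η ∈ E, ξ < η := by
    intro ξ
    obtain ⟨ζ, hζ⟩ := Omega1.exists_gt ξ
    obtain ⟨η, hη, h⟩ := hE.isCofinal ζ
    exact ⟨η, hη, hζ.trans_le h⟩
  choose g hgE hg using hex
  have hconst : ∀ ξ : Omega1.{u}, CountableIn X fun _ => ({d ξ} : Set α) := fun ξ _ =>
    ⟨singleton_subset_iff.2 (hX ξ ξ.2), countable_singleton _⟩
  obtain ⟨F, hF, hFd⟩ := exists_closedUnder_diagonal hd (G := fun ξ _ => {d (g ξ)})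
    fun ξ => hconst (g ξ)
  -- Putting d 0 into x makes δ_x positive, so that δ_x is the supremum of a nonempty subset of E.
  let o : Omega1.{u} := ⟨0, omega1_pos⟩
  refine ⟨_, hF.union (hconst o), fun x hx hxF => ?_⟩
  rw [closedUnder_union_iff] at hxF
  obtain ⟨δ, hδ⟩ := hx.2.2.exists_isDelta
  refine hδ.deltaMem_iff.2 ?_
  rw [isDelta_iff] at hδ
  have hg' : ∀ ξ < δ, g ξ < δ := fun ξ hξ =>
    (hδ _).1 (hFd x hxF.1 ξ ((hδ ξ).2 hξ) ∅ (by simp) rfl)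
  have ho : o < δ := (hδ o).1 (hxF.2 ∅ (by simp) rfl)
  refine hE.isLUB_mem (t := g '' Iio δ) (by rintro _ ⟨ξ, -, rfl⟩; exact hgE ξ) ⟨g o, o, ho, rfl⟩
    ⟨?_, fun b hb => ?_⟩
  · rintro _ ⟨ξ, hξ, rfl⟩
    exact (hg' ξ hξ).le
  · by_contra hc
    exact (hb ⟨b, not_le.1 hc, rfl⟩).not_gt (hg b)

/-- For stationary `B ⊆ ω₁`, stationarily many members of the space have `δ_x ∈ B`. -/
theorem isStationaryIn_restr_space (hd : d.Injective) (hX : ∀ ξ < ω_ 1, d ξ ∈ X)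
    {B : Set Omega1.{u}} (hB : IsStationary B) :
    IsStationaryIn (Space d X) (restr d (Space d X) B) := by
  rw [isStationaryIn_iff hd hX]
  refine ⟨restr_subset _ _, fun F hF => ?_⟩
  have hG := hF.union (countableIn_down hd hX)
  let K : Set Omega1.{u} → Set α := fun s => cl (fun e => F e ∪ down d e) ((fun ξ => d ξ.1) '' s)
  have hdinj : Function.Injective fun ξ : Omega1.{u} => d ξ.1 := hd.comp Subtype.val_injective
  -- The closure of a countable initial segment reaches only boundedly far into ω₁; at a δ closed
  -- under these bounds, the closure of δ adds no countable ordinal.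
  have hb : ∀ β : Omega1.{u}, ∃ γ, ∀ ξ : Omega1.{u}, d ξ ∈ K (Iic β) → ξ < γ := fun β =>
    Omega1.exists_gt_of_countable (s := (fun ξ : Omega1.{u} => d ξ.1) ⁻¹' K (Iic β))
      ((countable_cl (fun e => (hG e).2) ((Omega1.countable_Iic β).image _)).preimage hdinj)
  choose g hg using hb
  obtain ⟨δ, hδB, hδ, hδ0⟩ := hB ((isClub_closed_under g).inter cof_omega1_ne
    (isClub_Ioi (⟨0, omega1_pos⟩ : Omega1.{u})))
  have hcl := closedUnder_union_iff.1
    (closedUnder_cl (fun e => F e ∪ down d e) ((fun ξ : Omega1.{u} => d ξ.1) '' Iio δ))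
  refine ⟨K (Iio δ), ⟨mem_space_of_closedUnder_down hd (cl_subset ?_ hG.closedUnder)
    (countable_cl (fun e => (hG e).2) ((Omega1.countable_Iio δ).image _)) hcl.2, ?_⟩, hcl.1⟩
  · rintro _ ⟨ξ, -, rfl⟩
    exact hX ξ ξ.2
  · refine ⟨δ, hδB, (isDelta_iff (δ := δ)).2 fun ξ => ⟨fun hξ => ?_, fun hξ =>
      subset_cl _ _ ⟨ξ, hξ, rfl⟩⟩⟩
    obtain ⟨e, he, hξe⟩ := exists_finset_of_mem_cl (show d ξ ∈ K (Iio δ) from hξ)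
    obtain ⟨β, hβ, heβ⟩ : ∃ β < δ, ↑e ⊆ (fun ξ : Omega1.{u} => d ξ.1) '' Iic β := by
      have hne : Nonempty (Iio δ) := ⟨⟨_, hδ0⟩⟩
      have hdir : Directed (· ⊆ ·) fun β : Iio δ => (fun ξ : Omega1.{u} => d ξ.1) '' Iic β.1 :=
        Monotone.directed_le fun β γ h => image_mono (Iic_subset_Iic.2 h)
      obtain ⟨β, hβ⟩ := Directed.exists_mem_subset_of_finset_subset_biUnion hdir (s := e) (by
        intro a ha
        obtain ⟨β, hβ, rfl⟩ := he ha
        exact mem_iUnion.2 ⟨⟨β, hβ⟩, β, self_mem_Iic, rfl⟩)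
      exact ⟨β.1, β.2, hβ⟩
    exact (hg β ξ (cl_mono heβ hξe)).trans (hδ β hβ)

theorem trace_inter_Iio {κ : Cardinal.{u}} (hκ : ω_ 1 ≤ κ.ord) (y : Set Ordinal.{u}) :
    trace (y ∩ Iio κ.ord) = trace y := by
  ext ξ
  exact ⟨fun h => ⟨h.1.1, h.2⟩, fun h => ⟨⟨h.1, lt_of_lt_of_le h.2 hκ⟩, h.2⟩⟩

theorem inter_mem_Pω (hd : d.Injective) {κ : Cardinal.{u}} (hκ : ω_ 1 ≤ κ.ord) {N : Set α}
    (hN : N ∈ Space d X) : d ⁻¹' N ∩ Iio κ.ord ∈ Pω κ := by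
  refine ⟨inter_subset_right, (hN.2.1.preimage hd).mono inter_subset_left, ?_⟩
  rw [HasDelta, trace_inter_Iio hκ]
  exact hN.2.2

theorem deltaMem_inter_iff {κ : Cardinal.{u}} (hκ : ω_ 1 ≤ κ.ord) {y : Set Ordinal.{u}}
    {A : Set Omega1.{u}} : DeltaMem (y ∩ Iio κ.ord) A ↔ DeltaMem y A := by
  simp only [DeltaMem, trace_inter_Iio hκ]

/-- A stationary subset of `[κ]^ω` lifts to a stationary set of a larger space. -/
theorem isStationaryIn_lift (hd : d.Injective) {κ : Cardinal.{u}} (hκ : ω_ 1 ≤ κ.ord)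
    (hX : ∀ ξ < κ.ord, d ξ ∈ X) {S : Set (Set Ordinal.{u})} (hS : IsStationaryIn (Pω κ) S) :
    IsStationaryIn (Space d X) {N ∈ Space d X | d ⁻¹' N ∩ Iio κ.ord ∈ S} := by
  have hX1 : ∀ ξ < ω_ 1, d ξ ∈ X := fun ξ h => hX ξ (h.trans_le hκ)
  rw [isStationaryIn_iff hd hX1]
  refine ⟨sep_subset _ _, fun F hF => ?_⟩
  have hG := hF.union (countableIn_down hd hX1)
  let K : Set Ordinal.{u} → Set α := fun s => cl (fun e => F e ∪ down d e) (d '' s)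
  rw [Pω_eq_space, isStationaryIn_iff (X := Iio κ.ord) Function.injective_id
    fun ξ h => lt_of_lt_of_le h hκ] at hS
  -- The function on κ collects the ordinals below κ generated by e over X, so the closure of x in X
  -- adds no ordinal below κ to x.
  obtain ⟨x, hxS, hx⟩ := hS.2 (fun e => d ⁻¹' K ↑e ∩ Iio κ.ord) fun e => ⟨inter_subset_right,
    ((countable_cl (fun e => (hG e).2) (e.countable_toSet.image d)).preimage hd).mono
      inter_subset_left⟩
  have hxP := hS.1 hxS
  have hcl := closedUnder_union_iff.1 (closedUnder_cl (fun e => F e ∪ down d e) (d '' x))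
  have hKx : d ⁻¹' K x ∩ Iio κ.ord = x := by
    classical
    refine Subset.antisymm ?_ fun ξ hξ => ⟨subset_cl _ _ ⟨ξ, hξ, rfl⟩, hxP.1 hξ⟩
    rintro ξ ⟨hξ, hξκ⟩
    obtain ⟨e, he, hξe⟩ := exists_finset_of_mem_cl (show d ξ ∈ K x from hξ)
    obtain ⟨e', he', rfl⟩ := Finset.subset_set_image_iff.1 he
    refine hx e' he' ⟨?_, hξκ⟩
    rw [Finset.coe_image] at hξe
    exact hξe
  refine ⟨K x, ⟨mem_space_of_closedUnder_down hd (cl_subset ?_ hG.closedUnder)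
    (countable_cl (fun e => (hG e).2) (hxP.2.1.image d)) hcl.2, hKx.symm ▸ hxS⟩, hcl.1⟩
  rintro _ ⟨ξ, hξ, rfl⟩
  exact hX ξ (hxP.1 hξ)

theorem IsStationaryIn.inter_closedUnder (hd : d.Injective) (hX : ∀ ξ < ω_ 1, d ξ ∈ X)
    {S : Set (Set α)} (hS : IsStationaryIn (Space d X) S) {F : Finset α → Set α}
    (hF : CountableIn X F) : IsStationaryIn (Space d X) {x ∈ S | ClosedUnder F x} := by
  rw [isStationaryIn_iff hd hX] at hS ⊢
  refine ⟨(sep_subset _ _).trans hS.1, fun G hG => ?_⟩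
  obtain ⟨x, hx, h⟩ := hS.2 _ (hF.union hG)
  rw [closedUnder_union_iff] at h
  exact ⟨x, ⟨hx, h.1⟩, h.2⟩

end

/-! ### Chains, and the set A obtained from SRP -/

section

variable {α : Type v} {d : Ordinal.{u} → α} {X : Set α}

/-- `S` contains an `ω₁`-chain, for a set `S` of subsets of an arbitrary type. -/
def ContainsChainIn (d : Ordinal.{u} → α) (S : Set (Set α)) : Prop :=
  ∃ x : Omega1.{u} → Set α,
    (∀ α, x α ∈ S) ∧
    (∀ α β, α < β → x α ⊆ x β ∧ trace (d ⁻¹' x α) ⊂ trace (d ⁻¹' x β)) ∧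
    (∀ γ, Order.IsSuccLimit γ → x γ = ⋃ α ∈ Iio γ, x α)

/-- The `γ`-th term of an `ω₁`-chain has `δ = γ`, for almost all `γ`. -/
theorem ContainsChainIn.exists_isClub {S : Set (Set α)} (hS : S ⊆ Space d X)
    (h : ContainsChainIn d S) :
    ∃ x : Omega1.{u} → Set α, (∀ γ, x γ ∈ S) ∧ ∃ E, IsClub E ∧ ∀ γ ∈ E,
      IsDelta (d ⁻¹' x γ) γ ∧ x γ = ⋃ β ∈ Iio γ, x β := by
  obtain ⟨x, hxS, hmono, hlim⟩ := h
  choose δ hδ using fun γ => (hS (hxS γ)).2.2.exists_isDelta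
  have hδmono : StrictMono δ := by
    intro β γ h
    have h1 : Iio (δ β).1 ⊂ Iio (δ γ).1 := by
      have := (hmono β γ h).2
      rwa [show trace (d ⁻¹' x β) = _ from hδ β, show trace (d ⁻¹' x γ) = _ from hδ γ] at this
    by_contra hc
    exact h1.not_subset (Iio_subset_Iio (not_lt.1 hc))
  -- A positive γ closed under g is a limit with δ_β < γ for all β < γ; since ξ ≤ δ_ξ by strict
  -- monotonicity, the union of the earlier terms has δ exactly γ.
  choose g hg using fun ξ : Omega1.{u} => Omega1.exists_gt (max ξ (δ ξ))
  refine ⟨x, hxS, _, (isClub_closed_under g).inter cof_omega1_ne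
    (isClub_Ioi (⟨0, omega1_pos⟩ : Omega1.{u})), ?_⟩
  rintro γ ⟨hγ, hγ0⟩
  have hγlim : Order.IsSuccLimit γ := by
    refine ⟨fun hmin => (hmin (le_of_lt hγ0)).not_gt hγ0, fun ξ hξ => ?_⟩
    exact hξ.2 ((le_max_left _ _).trans_lt (hg ξ)) (hγ ξ hξ.1)
  have hxγ := hlim γ hγlim
  refine ⟨isDelta_iff.2 fun ξ => ⟨fun hξ => ?_, fun hξ => ?_⟩, hxγ⟩
  · have hξ' : d ξ ∈ ⋃ β ∈ Iio γ, x β := hxγ ▸ hξ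
    obtain ⟨β, hβ, hξβ⟩ := mem_iUnion₂.1 hξ'
    exact ((isDelta_iff.1 (hδ β) ξ).1 hξβ).trans
      (((le_max_right _ _).trans_lt (hg β)).trans (hγ β hβ))
  · have h1 : ξ < δ (g ξ) :=
      (hδmono.le_apply (x := ξ)).trans_lt (hδmono ((le_max_left _ _).trans_lt (hg ξ)))
    have h2 : ξ.1 ∈ d ⁻¹' x (g ξ) := (isDelta_iff.1 (hδ (g ξ)) ξ).2 h1
    rw [hxγ]
    exact mem_iUnion₂.2 ⟨g ξ, hγ ξ hξ, h2⟩

theorem aleph_two_le_two_power : ℵ_ 2 ≤ (2 : Cardinal.{u}) ^ (ℵ₁ : Cardinal.{u}) := by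
  have h : (ℵ_ 2 : Cardinal.{u}) = Order.succ ℵ₁ := by
    rw [Cardinal.succ_aleph, one_add_one_eq_two]
  rw [h]
  exact Order.succ_le_of_lt (Cardinal.cantor _)

theorem omega1_le_ord {κ : Cardinal.{u}} (hκ : ℵ_ 2 ≤ κ) : ω_ 1 ≤ κ.ord := by
  rw [← Cardinal.ord_aleph]
  refine Cardinal.ord_le_ord.2 (le_trans ?_ hκ)
  exact Cardinal.aleph_le_aleph.2 (by norm_num)

/-- SRP speaks of sets of ordinals, so the subsets of ω₁ have to be coded by ordinals; the value
beyond 2^ℵ₁ is irrelevant. -/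
theorem exists_enumeration_sets :
    ∃ e : Ordinal.{u} → Set Omega1.{u}, ∀ B, ∃ ξ < ((2 : Cardinal.{u}) ^ (ℵ₁ : Cardinal.{u})).ord,
      e ξ = B := by
  classical
  have h : #(Iio ((2 : Cardinal.{u}) ^ (ℵ₁ : Cardinal.{u})).ord) = #(Set Omega1.{u}) := by
    rw [Cardinal.mk_Iio_ordinal, Cardinal.mk_set, mk_omega1, Cardinal.card_ord]
    simp
  obtain ⟨f⟩ := Cardinal.eq.1 h
  refine ⟨fun ξ => if hξ : ξ ∈ Iio ((2 : Cardinal.{u}) ^ (ℵ₁ : Cardinal.{u})).ord then f ⟨ξ, hξ⟩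
    else ∅, fun B => ⟨(f.symm B).1, (f.symm B).2, ?_⟩⟩
  exact (dif_pos (f.symm B).2).trans (f.apply_symm_apply B)

/-- Under SRP, every stationary set `S` is projective stationary above some stationary `A ⊆ ω₁`
and nonstationary above the complement of `A`. -/
theorem SRP.exists_isStationary (hSRP : SRP.{u}) (hd : d.Injective) (hX : ∀ ξ < ω_ 1, d ξ ∈ X)
    {S : Set (Set α)} (hS : IsStationaryIn (Space d X) S) :
    ∃ A : Set Omega1.{u}, IsStationary A ∧ ¬ IsStationaryIn (Space d X) (restr d S Aᶜ) ∧
      ∀ B ⊆ A, IsStationary B → IsStationaryIn (Space d X) (restr d S B) := by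
  have hSP := hS.1
  have hrP : ∀ B, restr d S B ⊆ Space d X := fun B => (restr_subset S B).trans hSP
  obtain ⟨e, he⟩ := exists_enumeration_sets.{u}
  set lam : Cardinal.{u} := (2 : Cardinal.{u}) ^ (ℵ₁ : Cardinal.{u}) with hlam
  have hlam2 : ℵ_ 2 ≤ lam := aleph_two_le_two_power
  have hlamX : ∀ ξ < (ω_ 1 : Ordinal.{u}), id ξ ∈ Iio lam.ord := fun ξ h =>
    lt_of_lt_of_le h (omega1_le_ord hlam2)
  let St : Set Omega1.{u} → Prop := fun B => IsStationaryIn (Space d X) (restr d S B)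
  let Hp : Set Omega1.{u} → Prop := fun B => ∀ B' ⊆ B, IsStationary B' → St B'
  let T : Set (Set Ordinal.{u}) :=
    {x ∈ Space id (Iio lam.ord) | ∃ ξ ∈ x, (¬ St (e ξ) ∨ Hp (e ξ)) ∧ DeltaMem x (e ξ)}
  have hT : IsProjectiveStationary lam T := by
    refine ⟨sep_subset _ _, fun B hB => ?_⟩
    -- If B is not of the second kind, a stationary subset of B witnessing this is of the first
    -- kind.
    obtain ⟨B₀, hB₀B, hB₀, hW⟩ : ∃ B₀ ⊆ B, IsStationary B₀ ∧ (¬ St B₀ ∨ Hp B₀) := by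
      by_cases h : Hp B
      · exact ⟨B, subset_rfl, hB, Or.inr h⟩
      · simp only [Hp] at h
        push Not at h
        obtain ⟨B', h1, h2, h3⟩ := h
        exact ⟨B', h1, h2, Or.inl h3⟩
    obtain ⟨ξ, hξ, rfl⟩ := he B₀
    refine ((isStationaryIn_restr_space Function.injective_id hlamX hB₀).inter_closedUnder
      Function.injective_id hlamX (F := fun _ => {ξ})
      fun _ => ⟨singleton_subset_iff.2 hξ, countable_singleton _⟩).mono ?_ ?_
    · rintro x ⟨⟨hx, hxB⟩, hxF⟩
      have hξx : ξ ∈ x := hxF ∅ (by simp) rfl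
      exact ⟨⟨hx, ξ, hξx, hW, hxB⟩, hxB.mono hB₀B⟩
    · rintro x hx
      exact hx.1.1
  obtain ⟨y, hyT, E, hE, hyE⟩ := ContainsChainIn.exists_isClub (d := id) (X := Iio lam.ord)
    (S := T) (sep_subset _ _) (hSRP lam hlam2 T hT)
  have hyc : ∀ β, (y β).Countable := fun β => (hyT β).1.2.1
  let A : Set Omega1.{u} := {γ | ∃ ξ ∈ y γ, Hp (e ξ) ∧ γ ∈ e ξ}
  have hA : ¬ St Aᶜ := by
    have hF : ∀ ζ : Ordinal.{u}, ∃ F, CountableIn X F ∧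
        (¬ St (e ζ) → ∀ x ∈ restr d S (e ζ), ¬ ClosedUnder F x) := by
      intro ζ
      by_cases h : St (e ζ)
      · exact ⟨_, countableIn_empty, fun h' => absurd h h'⟩
      · obtain ⟨F, hF, h'⟩ := exists_of_not_isStationaryIn hd hX (hrP _) h
        exact ⟨F, hF, fun _ => h'⟩
    choose F hF hFS using hF
    have hG : ∀ β : Omega1.{u}, ∃ G, CountableIn X G ∧
        ∀ x, ClosedUnder G x → ∀ ζ ∈ y β, ClosedUnder (F ζ) x := by
      intro β
      have := (hyc β).to_subtype
      obtain ⟨G, hG, h⟩ := exists_forall_closedUnder (G := fun ζ : y β => F ζ) fun ζ => hF ζ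
      exact ⟨G, hG, fun x hx ζ hζ => h x hx ⟨ζ, hζ⟩⟩
    choose G hG hGF using hG
    obtain ⟨F₁, hF₁, hF₁d⟩ := exists_closedUnder_diagonal hd hG
    obtain ⟨F₂, hF₂, hF₂E⟩ := exists_forall_deltaMem_of_isClub hd hX hE
    intro hst
    obtain ⟨x, ⟨hxS, δ, hδA, hδ⟩, hx⟩ := ((isStationaryIn_iff hd hX).1 hst).2 _ (hF₁.union hF₂)
    rw [closedUnder_union_iff] at hx
    have hδE : δ ∈ E := (IsDelta.deltaMem_iff (δ := δ) hδ).1 (hF₂E x (hSP hxS) hx.2)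
    obtain ⟨hyδ, hyU⟩ := hyE δ hδE
    obtain ⟨-, ξ, hξ, hW, hmem⟩ := hyT δ
    have hδξ : δ ∈ e ξ := (IsDelta.deltaMem_iff hyδ).1 hmem
    rcases hW with hW | hW
    -- By continuity the code ξ appears in y β for some β < δ, and x is closed under the functions
    -- attached to the codes in y β.
    · rw [hyU] at hξ
      obtain ⟨β, hβ, hξβ⟩ := mem_iUnion₂.1 hξ
      exact hFS ξ hW x ⟨hxS, δ, hδξ, hδ⟩ (hGF β x
        (hF₁d x hx.1 β ((isDelta_iff.1 hδ β).2 hβ)) ξ hξβ)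
    · exact hδA ⟨ξ, hξ, hW, hδξ⟩
  refine ⟨A, ?_, hA, fun B hBA hB => ?_⟩
  · by_contra h
    obtain ⟨D, hD, hdisj⟩ := not_isStationary_iff.1 h
    obtain ⟨F, hF, hFD⟩ := exists_forall_deltaMem_of_isClub hd hX hD
    refine hA ((hS.inter_closedUnder hd hX hF).mono ?_ (hrP _))
    rintro x ⟨hxS, hx⟩
    exact ⟨hxS, (hFD x (hSP hxS) hx).mono hdisj.symm.subset_compl_right⟩
  · by_contra hBst
    -- If `S` is nonstationary above B, then B meets every set of the second kind in a nonstationary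
    -- set; a diagonal intersection of the avoiding clubs meets B, yet each point of B ∩ E in it
    -- lies in such a set with an earlier code.
    have hC : ∀ ζ : Ordinal.{u}, ∃ C, IsClub C ∧ (Hp (e ζ) → Disjoint (B ∩ e ζ) C) := by
      intro ζ
      by_cases h : Hp (e ζ)
      · have h1 : ¬ IsStationary (B ∩ e ζ) := fun hs =>
          hBst ((h _ inter_subset_right hs).mono (restr_mono S inter_subset_left) (hrP _))
        obtain ⟨C, hC, h2⟩ := not_isStationary_iff.1 h1
        exact ⟨C, hC, fun _ => h2⟩
      · exact ⟨univ, IsClub.univ, fun h' => absurd h' h⟩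
    choose C hC hCd using hC
    have hCβ : ∀ β : Omega1.{u}, IsClub (⋂ ζ : y β, C ζ) := fun β =>
      have := (hyc β).to_subtype
      IsClub.iInter_of_countable cof_omega1_ne fun ζ => hC ζ
    obtain ⟨γ, hγB, hγE, hγ⟩ := hB (hE.inter cof_omega1_ne (isClub_diagonal hCβ))
    obtain ⟨ξ, hξ, hHp, hγξ⟩ := hBA hγB
    rw [(hyE γ hγE).2] at hξ
    obtain ⟨β, hβ, hξβ⟩ := mem_iUnion₂.1 hξ
    exact disjoint_left.1 (hCd ξ hHp) ⟨hγB, hγξ⟩ (mem_iInter.1 (hγ β hβ) ⟨ξ, hξβ⟩)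

end

/-! ### SRP over arbitrary base sets, and ω₁-extensions -/

section

variable {α : Type v} {d : Ordinal.{u} → α} {X : Set α}

/-- A bijection between the cardinal `κ` and the base set `X` that agrees with `d` below `ω₁`. -/
theorem exists_coding (hd : d.Injective) (hX : ∀ ξ < ω_ 1, d ξ ∈ X) {κ : Cardinal.{u}}
    (hκ : ℵ_ 2 ≤ κ) (hcard : Nonempty (Iio κ.ord ≃ X)) :
    ∃ (j : Ordinal.{u} → α) (p : α → Ordinal.{u}),
      (∀ ξ < κ.ord, j ξ ∈ X ∧ p (j ξ) = ξ) ∧ (∀ a ∈ X, p a < κ.ord ∧ j (p a) = a) ∧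
      ∀ ξ < ω_ 1, j ξ = d ξ := by
  classical
  have h1 : (ω_ 1 : Ordinal.{u}) ≤ κ.ord := omega1_le_ord hκ
  let s : Set (Iio κ.ord) := {ξ | ξ.1 < ω_ 1}
  have hs : #s < #(Iio κ.ord) := by
    have h2 : #s ≤ #Omega1.{u} :=
      Cardinal.mk_le_of_injective (f := fun ξ : s => (⟨ξ.1.1, ξ.2⟩ : Omega1.{u}))
        fun a b h => Subtype.ext (Subtype.ext (congrArg (fun c : Omega1.{u} => c.1) h))
    refine h2.trans_lt ?_
    rw [mk_omega1, Cardinal.mk_Iio_ordinal, Cardinal.card_ord, Cardinal.aleph_one_lt_lift]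
    exact lt_of_lt_of_le (Cardinal.aleph_lt_aleph.2 (by norm_num)) hκ
  let f₀ : s ↪ X := ⟨fun ξ => ⟨d ξ.1.1, hX _ ξ.2⟩, fun a b h =>
    Subtype.ext (Subtype.ext (hd (congrArg Subtype.val h)))⟩
  -- The prescribed part has size at most ℵ₁ < κ, so it extends to a bijection.
  obtain ⟨f, hf⟩ := Cardinal.extend_function_of_lt f₀ hs hcard
  refine ⟨fun ξ => if h : ξ < κ.ord then f ⟨ξ, h⟩ else d ξ,
    fun a => if h : a ∈ X then (f.symm ⟨a, h⟩).1 else 0, fun ξ hξ => ?_, fun a ha => ?_,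
    fun ξ hξ => ?_⟩
  · simp only [dif_pos hξ]
    refine ⟨(f ⟨ξ, hξ⟩).2, ?_⟩
    rw [dif_pos (f ⟨ξ, hξ⟩).2]
    simp
  · simp only [dif_pos ha]
    have hlt : (f.symm ⟨a, ha⟩).1 < κ.ord := (f.symm ⟨a, ha⟩).2
    refine ⟨hlt, ?_⟩
    rw [dif_pos hlt]
    simp
  · have hlt := lt_of_lt_of_le hξ h1
    simp only [dif_pos hlt]
    exact congrArg Subtype.val (hf ⟨⟨ξ, hlt⟩, hξ⟩)

/-- SRP for the countable subsets of an arbitrary set of cardinality at least `ℵ₂`. -/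
theorem SRP.containsChainIn (hSRP : SRP.{u}) (hd : d.Injective) (hX : ∀ ξ < ω_ 1, d ξ ∈ X)
    {κ : Cardinal.{u}} (hκ : ℵ_ 2 ≤ κ) (hcard : Nonempty (Iio κ.ord ≃ X)) {S : Set (Set α)}
    (hSP : S ⊆ Space d X)
    (hS : ∀ B, IsStationary B → IsStationaryIn (Space d X) (restr d S B)) :
    ContainsChainIn d S := by
  classical
  obtain ⟨j, p, hj, hp, hjd⟩ := exists_coding hd hX hκ hcard
  have h1 : (ω_ 1 : Ordinal.{u}) ≤ κ.ord := omega1_le_ord hκ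
  have hκX : ∀ ξ < (ω_ 1 : Ordinal.{u}), id ξ ∈ Iio κ.ord := fun ξ h => lt_of_lt_of_le h h1
  have htr : ∀ y ⊆ Iio κ.ord, trace (d ⁻¹' (j '' y)) = trace y := by
    intro y hy
    ext ξ
    refine and_congr_left fun hξ => ⟨?_, fun h => ⟨ξ, h, hjd ξ hξ⟩⟩
    rintro ⟨η, hη, h⟩
    rw [← hjd ξ hξ] at h
    have := congrArg p h
    rw [(hj η (hy hη)).2, (hj ξ (lt_of_lt_of_le hξ h1)).2] at this
    exact this ▸ hη
  have hjp : ∀ x ⊆ X, j '' (p '' x) = x := by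
    intro x hx
    rw [image_image]
    exact (image_congr fun a ha => (hp a (hx ha)).2).trans (image_id' x)
  let S' : Set (Set Ordinal.{u}) := {y ∈ Pω κ | j '' y ∈ S}
  have hS' : IsProjectiveStationary κ S' := by
    refine ⟨sep_subset _ _, fun B hB => ?_⟩
    rw [Pω_eq_space, isStationaryIn_iff (X := Iio κ.ord) Function.injective_id hκX]
    refine ⟨fun y hy => hy.1.1, fun G hG => ?_⟩
    obtain ⟨x, ⟨hxS, hxB⟩, hx⟩ := ((isStationaryIn_iff hd hX).1 (hS B hB)).2
      (fun e => j '' G (e.image p)) fun e => ⟨by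
        rintro _ ⟨ξ, hξ, rfl⟩
        exact (hj ξ ((hG _).1 hξ)).1, (hG _).2.image j⟩
    have hxP := hSP hxS
    have hpx : p '' x ⊆ Iio κ.ord := by
      rintro _ ⟨a, ha, rfl⟩
      exact (hp a (hxP.1 ha)).1
    have htx : trace (p '' x) = trace (d ⁻¹' x) := by
      rw [← htr _ hpx, hjp x hxP.1]
    refine ⟨p '' x, ⟨⟨⟨hpx, hxP.2.1.image p, ?_⟩, ?_⟩, ?_⟩, fun e he ξ hξ => ?_⟩
    · rw [HasDelta, htx]
      exact hxP.2.2
    · rw [hjp x hxP.1]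
      exact hxS
    · rw [DeltaMem, htx]
      exact hxB
    · obtain ⟨e', he', rfl⟩ := Finset.subset_set_image_iff.1 he
      exact ⟨j ξ, hx e' he' ⟨ξ, hξ, rfl⟩, (hj ξ ((hG _).1 hξ)).2⟩
  obtain ⟨y, hyS, hmono, hlim⟩ := hSRP κ hκ S' hS'
  refine ⟨fun γ => j '' y γ, fun γ => (hyS γ).2, fun β γ h => ⟨image_mono (hmono β γ h).1, ?_⟩,
    fun γ hγ => ?_⟩
  · rw [htr _ (hyS β).1.1, htr _ (hyS γ).1.1]
    exact (hmono β γ h).2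
  · simp only [hlim γ hγ, image_iUnion]

/-- If `G` is stationary above each stationary subset of `A`, then almost all `x` with `δ_x ∈ A`
have an `ω₁`-extension in `G`. -/
theorem SRP.exists_extension (hSRP : SRP.{u}) (hd : d.Injective) (hX : ∀ ξ < ω_ 1, d ξ ∈ X)
    {κ : Cardinal.{u}} (hκ : ℵ_ 2 ≤ κ) (hcard : Nonempty (Iio κ.ord ≃ X)) {G : Set (Set α)}
    {A : Set Omega1.{u}}
    (hG : ∀ B ⊆ A, IsStationary B → IsStationaryIn (Space d X) (restr d G B)) :
    ∃ D, IsClubIn (Space d X) D ∧ ∀ x ∈ D, DeltaMem (d ⁻¹' x) A →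
      ∃ y ∈ G, x ⊆ y ∧ trace (d ⁻¹' x) = trace (d ⁻¹' y) := by
  let Y : Set (Set α) := {x ∈ Space d X | DeltaMem (d ⁻¹' x) A ∧
    ¬ ∃ y ∈ G, x ⊆ y ∧ trace (d ⁻¹' x) = trace (d ⁻¹' y)}
  have hYP : Y ⊆ Space d X := sep_subset _ _
  by_cases hY : IsStationaryIn (Space d X) Y
  swap
  · obtain ⟨F, hF, h⟩ := exists_of_not_isStationaryIn hd hX hYP hY
    exact ⟨_, isClubIn_closedUnder hd hX hF, fun x hx hxA => by_contra fun hc =>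
      h x ⟨hx.1, hxA, hc⟩ hx.2⟩
  exfalso
  obtain ⟨A', hA', -, hYA'⟩ := hSRP.exists_isStationary hd hX hY
  -- Were A' \ A stationary, some member of Y would have its δ outside A.
  have hAA' : IsStationary (A' ∩ A) := by
    rw [← inter_union_sdiff A' A, isStationary_union_iff cof_omega1_ne] at hA'
    refine hA'.resolve_right fun h => ?_
    obtain ⟨x, ⟨⟨-, ⟨δ, hδA, hδ⟩, -⟩, hx⟩, -⟩ :=
      ((isStationaryIn_iff hd hX).1 (hYA' _ sdiff_subset h)).2 _ countableIn_empty
    exact ((IsDelta.deltaMem_iff (δ := δ) hδ).1 hx).2 hδA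
  -- Y is large only above A'; all sets with δ outside A' are added to make Z projective stationary.
  let Z : Set (Set α) := Y ∪ restr d (Space d X) A'ᶜ
  have hZP : Z ⊆ Space d X := union_subset hYP (restr_subset _ _)
  have hZ : ∀ B, IsStationary B → IsStationaryIn (Space d X) (restr d Z B) := by
    intro B hB
    have hsub : restr d Z B ⊆ Space d X := (restr_subset _ _).trans hZP
    rw [← inter_union_sdiff B A', isStationary_union_iff cof_omega1_ne] at hB
    rcases hB with h | h
    · exact (hYA' _ inter_subset_right h).mono
        (fun x hx => ⟨Or.inl hx.1, hx.2.mono inter_subset_left⟩) hsub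
    · exact (isStationaryIn_restr_space hd hX h).mono
        (fun x hx => ⟨Or.inr ⟨hx.1, hx.2.mono fun _ h => h.2⟩, hx.2.mono sdiff_subset⟩) hsub
  obtain ⟨y, hyZ, E, hE, hyE⟩ :=
    (hSRP.containsChainIn hd hX hκ hcard hZP hZ).exists_isClub hZP
  obtain ⟨F₁, hF₁, hF₁d⟩ := exists_closedUnder_diagonal (X := X) hd (G := fun β _ => y β)
    fun β _ => ⟨(hZP (hyZ β)).1, (hZP (hyZ β)).2.1⟩
  obtain ⟨F₂, hF₂, hF₂E⟩ := exists_forall_deltaMem_of_isClub hd hX hE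
  have hGst := (isStationaryIn_iff hd hX).1 (hG _ inter_subset_right hAA')
  obtain ⟨x, hxG, hx⟩ := hGst.2 _ (hF₁.union hF₂)
  rw [closedUnder_union_iff] at hx
  have hxP := hGst.1 hxG
  obtain ⟨δ, hδ⟩ := hxP.2.2.exists_isDelta
  have hδA : δ ∈ A' ∩ A := hδ.deltaMem_iff.1 hxG.2
  have hδE : δ ∈ E := hδ.deltaMem_iff.1 (hF₂E x hxP hx.2)
  obtain ⟨hyδ, hyU⟩ := hyE δ hδE
  -- x contains y β for every β < δ by the diagonal closure, hence also their union y δ.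
  have hyx : y δ ⊆ x := by
    rw [hyU]
    exact iUnion₂_subset fun β hβ =>
      hF₁d x hx.1 β ((isDelta_iff.1 hδ β).2 hβ) ∅ (by simp)
  rcases hyZ δ with h | h
  · exact h.2.2 ⟨x, hxG.1, hyx, Eq.trans hyδ (Eq.symm hδ)⟩
  · exact hyδ.deltaMem_iff.1 h.2 hδA.1

end

/-! ### The sets `H_{κ⁺}` -/

/-- By regularity, fewer than μ ranks below μ have their supremum below μ. This bound makes H_μ
small, so that it can be indexed by a cardinal. -/
theorem rank_lt_of_mem_H {μ : Cardinal.{u}} (hμ : μ.IsRegular) (a : ZFSet.{u}) (ha : a ∈ H μ) :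
    a.rank < μ.ord := by
  induction a using ZFSet.inductionOn with
  | _ a ih =>
    let f : Shrink.{u} a → Ordinal.{u} := fun y => Order.succ ((equivShrink a).symm y).1.rank
    have hlim : Order.IsSuccLimit μ.ord := Cardinal.isSuccLimit_ord hμ.aleph0_le
    have hsup : ⨆ y, f y < μ.ord := by
      refine Ordinal.iSup_lt_of_lt_cof ?_ fun y => ?_
      · exact lt_of_lt_of_le (ZFSet.Hereditarily.self ha) hμ.2
      · exact hlim.succ_lt (ih _ ((equivShrink a).symm y).2
          (ZFSet.Hereditarily.mem ha ((equivShrink a).symm y).2))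
    refine lt_of_le_of_lt (ZFSet.rank_le_iff.2 fun y hy => ?_) hsup
    refine lt_of_lt_of_le ?_ (Ordinal.le_iSup f (equivShrink a ⟨y, hy⟩))
    simp [f]

theorem toZFSet_mem_H {κ : Cardinal.{u}} (ξ : Ordinal.{u}) (hξ : ξ < κ.ord) :
    ξ.toZFSet ∈ H (Order.succ κ) := by
  induction ξ using WellFoundedLT.induction with
  | _ ξ ih =>
    refine ZFSet.hereditarily_iff.2 ⟨?_, fun y hy => ?_⟩
    · rw [Ordinal.card_toZFSet]
      exact (Cardinal.lt_ord.1 hξ).trans (Order.lt_succ κ)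
    · obtain ⟨η, hη, rfl⟩ := Ordinal.mem_toZFSet_iff.1 hy
      exact ih η hη (hη.trans hξ)

theorem exists_equiv_H {κ : Cardinal.{u}} (hκ : ℵ₀ ≤ κ) :
    ∃ lam : Cardinal.{u}, κ ≤ lam ∧ Nonempty (Iio lam.ord ≃ H (Order.succ κ)) := by
  have hsub : H (Order.succ κ) ⊆ {x | x ∈ ZFSet.vonNeumann (Order.succ κ).ord} := fun a ha =>
    ZFSet.mem_vonNeumann.2 (rank_lt_of_mem_H (Cardinal.isRegular_succ hκ) a ha)
  have hV : Small.{u} {x | x ∈ ZFSet.vonNeumann (Order.succ κ).ord} :=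
    inferInstanceAs (Small.{u} (ZFSet.vonNeumann (Order.succ κ).ord))
  have hsm : Small.{u} (H (Order.succ κ)) := small_subset hsub
  have hmk : Cardinal.lift.{u + 1} #(Shrink.{u} (H (Order.succ κ))) = #(H (Order.succ κ)) :=
    Cardinal.lift_mk_shrink'' _
  refine ⟨#(Shrink.{u} (H (Order.succ κ))), ?_, ?_⟩
  · have hκc : #(Iio κ.ord) = Cardinal.lift.{u + 1} κ := by
      rw [Cardinal.mk_Iio_ordinal, Cardinal.card_ord]
    rw [← Cardinal.lift_le.{u + 1}, hmk, ← hκc]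
    exact Cardinal.mk_le_of_injective
      (f := fun ξ : Iio κ.ord => (⟨ξ.1.toZFSet, toZFSet_mem_H ξ.1 ξ.2⟩ : H (Order.succ κ)))
      fun a b h => Subtype.ext (Ordinal.toZFSet_injective (congrArg Subtype.val h))
  · refine Cardinal.eq.1 ?_
    rw [Cardinal.mk_Iio_ordinal, Cardinal.card_ord, hmk]

/-! ### Elementary submodels -/

open FirstOrder Language Structure in
/-- Sets closed under a suitable function (which comes from Skolem functions) are universes of
elementary submodels. -/
theorem exists_closedUnder_isElemSubmodel (L : FirstOrder.Language.{v, w}) [Countable L.Symbols]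
    {E : Set Ordinal.{u}} [Nonempty E] [L.Structure E] :
    ∃ F, CountableIn E F ∧ ∀ x ⊆ E, ClosedUnder F x → IsElemSubmodel L (E := E) x := by
  classical
  have hL : Countable (Σ n, (L.sum L.skolem₁).Functions n) := by
    rw [← Cardinal.mk_le_aleph0_iff]
    refine FirstOrder.Language.card_functions_sum_skolem₁_le.trans (max_le le_rfl ?_)
    exact Cardinal.mk_le_aleph0_iff.2 (inferInstanceAs (Countable L.Symbols))
  refine ⟨fun e => ⋃ f : Σ n, (L.sum L.skolem₁).Functions n,
    (fun v : Fin f.1 → E => ((funMap f.2 v : E) : Ordinal.{u})) ''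
      {v | ∀ i, v i ∈ ((↑) : E → Ordinal.{u}) ⁻¹' ↑e},
    fun e => ⟨?_, ?_⟩, fun x hxE hx => ?_⟩
  · refine iUnion_subset fun f => ?_
    rintro _ ⟨v, -, rfl⟩
    exact (funMap f.2 v : E).2
  · refine countable_iUnion fun f => Countable.image (Set.Finite.countable ?_) _
    exact Set.Finite.pi' fun i => e.finite_toSet.preimage Subtype.val_injective.injOn
  · let N : (L.sum L.skolem₁).Substructure E :=
      { carrier := ((↑) : E → Ordinal.{u}) ⁻¹' x
        fun_mem := by
          intro n f v hv
          let e : Finset Ordinal.{u} := Finset.univ.image fun i : Fin n => (v i).1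
          have he : ∀ a, a ∈ e ↔ ∃ i, (v i).1 = a := fun a => by simp [e]
          refine hx e (fun a ha => ?_) (mem_iUnion.2 ⟨⟨n, f⟩, v, fun i => (he _).2 ⟨i, rfl⟩, rfl⟩)
          obtain ⟨i, rfl⟩ := (he a).1 ha
          exact hv i }
    refine ⟨N.elementarySkolem₁Reduct, ?_⟩
    change x = ((↑) : E → Ordinal.{u}) '' (((↑) : E → Ordinal.{u}) ⁻¹' x)
    rw [Subtype.image_preimage_coe, inter_eq_right.2 hxE]

open FirstOrder Language Structure in
/-- A model with universe `E` in a countable language whose elementary submodels are closed under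
a given function. -/
theorem exists_structure_closedUnder {E : Set Ordinal.{u}} [Nonempty E]
    {F : Finset Ordinal.{u} → Set Ordinal.{u}} (hF : CountableIn E F) :
    ∃ (L : FirstOrder.Language.{v, w}) (_ : Countable L.Symbols) (_ : L.Structure E),
      ∀ x, IsElemSubmodel L (E := E) x → ClosedUnder F x := by
  classical
  have hen : ∀ e, ∃ g : ℕ → E, F e ⊆ range fun n => (g n).1 := by
    intro e
    rcases (F e).eq_empty_or_nonempty with h | h
    · exact ⟨fun _ => Classical.arbitrary E, h ▸ empty_subset _⟩
    · obtain ⟨g, hg⟩ := (hF e).2.exists_eq_range h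
      exact ⟨fun n => ⟨g n, (hF e).1 (hg ▸ mem_range_self n)⟩, hg.subset⟩
  choose g hg using hen
  -- In every arity the k-th symbol returns the k-th element of F applied to the set of arguments,
  -- so a finite e is treated by the arity `e.card`.
  let L : FirstOrder.Language.{v, w} := ⟨fun _ => ULift.{v} ℕ, fun _ => PEmpty.{w + 1}⟩
  let I : L.Structure E := ⟨fun {n} k v => g (Finset.univ.image fun i : Fin n => (v i).1) k.down,
    fun r _ => PEmpty.elim r⟩
  refine ⟨L, inferInstanceAs
    (Countable ((Σ _ : ℕ, ULift.{v} ℕ) ⊕ (Σ _ : ℕ, PEmpty.{w + 1}))), I, ?_⟩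
  rintro _ ⟨N, rfl⟩ e he a ha
  obtain ⟨k, rfl⟩ := hg e ha
  have hv : ∀ i : Fin e.card, ∃ b : E, b ∈ N ∧ b.1 = (e.equivFin.symm i).1 := fun i => by
    obtain ⟨b, hb, h⟩ := he (e.equivFin.symm i).2
    exact ⟨b, hb, h⟩
  choose v hvN hve using hv
  have himg : (Finset.univ.image fun i => (v i).1) = e := by
    ext a
    simp only [hve, Finset.mem_image, Finset.mem_univ, true_and]
    refine ⟨?_, fun ha => ⟨e.equivFin ⟨a, ha⟩, by simp⟩⟩
    rintro ⟨i, rfl⟩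
    exact (e.equivFin.symm i).2
  have := N.toSubstructure.fun_mem (n := e.card) (ULift.up k) v hvN
  change g (Finset.univ.image fun i => (v i).1) k ∈ N at this
  rw [himg] at this
  exact ⟨_, this, rfl⟩

/-! ### Uniqueness of the structure set -/

/-- Rank inverts the embedding of the ordinals into sets, so F transfers to H_{κ⁺}. Some M in the
club D has δ_M ∈ B, and the trace on κ of its extension N is the required y. -/
theorem SpanningAbove.exists_closedUnder {κ : Cardinal.{u}} (hκ : ω_ 1 ≤ κ.ord)
    {S : Set (Set Ordinal.{u})} {A B : Set Omega1.{u}} (h : SpanningAbove κ S A) (hBA : B ⊆ A)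
    (hB : IsStationary B) {F : Finset Ordinal.{u} → Set Ordinal.{u}}
    (hF : CountableIn (Iio κ.ord) F) :
    ∃ y ∈ S, y ∈ Pω κ ∧ ClosedUnder F y ∧ DeltaMem y B := by
  classical
  have hX : ∀ ξ < ω_ 1, ξ.toZFSet ∈ H (Order.succ κ) := fun ξ hξ =>
    toZFSet_mem_H ξ (lt_of_lt_of_le hξ hκ)
  have hF' : CountableIn (H (Order.succ κ)) fun e => Ordinal.toZFSet '' F (e.image ZFSet.rank) :=
    fun e => ⟨by
      rintro _ ⟨ξ, hξ, rfl⟩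
      exact toZFSet_mem_H ξ ((hF _).1 hξ), (hF _).2.image _⟩
  obtain ⟨D, hD, hDC⟩ := h _ (isClubIn_closedUnder Ordinal.toZFSet_injective hX hF')
  obtain ⟨M, ⟨-, hMB⟩, hMD⟩ :=
    (isStationaryIn_restr_space Ordinal.toZFSet_injective hX hB).2 D hD
  obtain ⟨N, ⟨hN, hNF⟩, hMN, hNS⟩ := hDC M hMD (DeltaMem.mono hMB hBA)
  refine ⟨_, hNS, inter_mem_Pω Ordinal.toZFSet_injective hκ hN, fun e he ξ hξ => ?_,
    (deltaMem_inter_iff hκ).2 ?_⟩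
  · refine ⟨hNF (e.image Ordinal.toZFSet) ?_ ⟨ξ, ?_, rfl⟩, (hF e).1 hξ⟩
    · intro a ha
      obtain ⟨η, hη, rfl⟩ := Finset.mem_image.1 ha
      exact (he hη).1
    · rw [Finset.image_image]
      have : (ZFSet.rank ∘ Ordinal.toZFSet : Ordinal.{u} → Ordinal.{u}) = id :=
        funext Ordinal.rank_toZFSet
      rwa [this, Finset.image_id]
  · rw [DeltaMem, ← hMN.2]
    exact hMB

/-- F is built into a model on κ, and M is taken closed under Skolem functions; the extension N,
being elementary, is closed under F. -/
theorem ModelExt.exists_closedUnder {κ : Cardinal.{u}} (hκ : ω_ 1 ≤ κ.ord)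
    {S : Set (Set Ordinal.{u})} {A B : Set Omega1.{u}} (h : ModelExt.{u, v, w} κ κ S A)
    (hBA : B ⊆ A) (hB : IsStationary B) {F : Finset Ordinal.{u} → Set Ordinal.{u}}
    (hF : CountableIn (Iio κ.ord) F) :
    ∃ y ∈ S, y ∈ Pω κ ∧ ClosedUnder F y ∧ DeltaMem y B := by
  have hX : ∀ ξ < (ω_ 1 : Ordinal.{u}), id ξ ∈ Iio κ.ord := fun ξ hξ => lt_of_lt_of_le hξ hκ
  have : Nonempty (Iio κ.ord) := ⟨⟨0, omega1_pos.trans_le hκ⟩⟩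
  obtain ⟨L, _, _, hL⟩ := exists_structure_closedUnder.{u, v, w} hF
  obtain ⟨D, hD, hDN⟩ := h L
  obtain ⟨G, hG, hGL⟩ := exists_closedUnder_isElemSubmodel L (E := Iio κ.ord)
  obtain ⟨M, ⟨⟨hMP, hMB⟩, hMG⟩, hMD⟩ :=
    ((isStationaryIn_restr_space Function.injective_id hX hB).inter_closedUnder
      Function.injective_id hX hG).2 D hD
  obtain ⟨N, hN, hNL, hMN, hNS⟩ := hDN M hMD (hGL M hMP.1 hMG) (DeltaMem.mono hMB hBA)
  rw [inter_eq_left.2 hN.1] at hNS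
  refine ⟨N, hNS, hN, hL N hNL, ?_⟩
  rw [DeltaMem, ← hMN.2]
  exact hMB

theorem not_isStationary_diff {κ : Cardinal.{u}} (hκ : ω_ 1 ≤ κ.ord)
    {S₁ S₂ : Set (Set Ordinal.{u})} (hS : EquivIn (Pω κ) S₁ S₂) {A₁ A₂ : Set Omega1.{u}}
    (h₁ : SpanningAbove κ S₁ A₁ ∨ ModelExt.{u, v, w} κ κ S₁ A₁)
    (h₂ : AlmostAllDeltaMem κ S₂ A₂) : ¬ IsStationary (A₁ \ A₂) := by
  intro hB
  have hX : ∀ ξ < (ω_ 1 : Ordinal.{u}), id ξ ∈ Iio κ.ord := fun ξ hξ => lt_of_lt_of_le hξ hκ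
  obtain ⟨C, hC, hCS⟩ := hS
  obtain ⟨C', hC', hCA⟩ := h₂
  obtain ⟨F, hF, hFC⟩ := IsClubIn.exists_closedUnder (d := id) Function.injective_id hX hC
  obtain ⟨F', hF', hFC'⟩ := IsClubIn.exists_closedUnder (d := id) Function.injective_id hX hC'
  obtain ⟨y, hyS, hyP, hyF, hyB⟩ :
      ∃ y ∈ S₁, y ∈ Pω κ ∧ ClosedUnder (fun e => F e ∪ F' e) y ∧ DeltaMem y (A₁ \ A₂) :=
    h₁.elim (fun h => h.exists_closedUnder hκ sdiff_subset hB (hF.union hF'))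
      fun h => h.exists_closedUnder hκ sdiff_subset hB (hF.union hF')
  rw [closedUnder_union_iff] at hyF
  have hyS₂ : y ∈ S₂ ∩ C := hCS ▸ ⟨hyS, hFC y hyP hyF.1⟩
  obtain ⟨δ, hδB, hδ⟩ := hyB
  exact hδB.2 ((IsDelta.deltaMem_iff (δ := δ) hδ).1 (hCA y (hFC' y hyP hyF.2) hyS₂.1))

theorem EquivIn.symm {P S₁ S₂ : Set (Set Ordinal.{u})} (h : EquivIn P S₁ S₂) :
    EquivIn P S₂ S₁ := by
  obtain ⟨C, hC, h⟩ := h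
  exact ⟨C, hC, h.symm⟩

theorem IsStructureSet.equivModClub {κ : Cardinal.{u}} (hκ : ω_ 1 ≤ κ.ord)
    {S₁ S₂ : Set (Set Ordinal.{u})} (hS : EquivIn (Pω κ) S₁ S₂) {A₁ A₂ : Set Omega1.{u}}
    (h₁ : IsStructureSet.{u, v, w} κ S₁ A₁) (h₂ : IsStructureSet.{u, v, w} κ S₂ A₂) :
    EquivModClub A₁ A₂ := by
  obtain ⟨C, hC, hd⟩ := not_isStationary_iff.1 (not_isStationary_diff hκ hS h₁.2.2 h₂.2.1)
  obtain ⟨C', hC', hd'⟩ :=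
    not_isStationary_iff.1 (not_isStationary_diff hκ hS.symm h₂.2.2 h₁.2.1)
  refine ⟨C ∩ C', hC.inter cof_omega1_ne hC', ?_⟩
  ext δ
  refine and_congr_left fun hδ => ⟨fun h => ?_, fun h => ?_⟩
  · by_contra hc
    exact disjoint_left.1 hd ⟨h, hc⟩ hδ.1
  · by_contra hc
    exact disjoint_left.1 hd' ⟨h, hc⟩ hδ.2

theorem equivIn_refl {κ : Cardinal.{u}} (hκ : ω_ 1 ≤ κ.ord) (S : Set (Set Ordinal.{u})) :
    EquivIn (Pω κ) S S :=
  ⟨_, isClubIn_closedUnder (d := id) (X := Iio κ.ord) Function.injective_id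
    (fun _ h => lt_of_lt_of_le h hκ) countableIn_empty, rfl⟩

/-! ### Spanning -/

/-- `S` is projective stationary above `A`. -/
def StationaryAbove (κ : Cardinal.{u}) (S : Set (Set Ordinal.{u})) (A : Set Omega1.{u}) : Prop :=
  ∀ B ⊆ A, IsStationary B → IsStationaryIn (Pω κ) {x ∈ S | DeltaMem x B}

theorem StationaryAbove.almostAllExt (hSRP : SRP.{u}) {κ : Cardinal.{u}} (hκ : ℵ_ 2 ≤ κ)
    {S : Set (Set Ordinal.{u})} {A : Set Omega1.{u}} (h : StationaryAbove κ S A) :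
    AlmostAllExt κ S A :=
  hSRP.exists_extension (d := id) (X := Iio κ.ord) Function.injective_id
    (fun _ h => lt_of_lt_of_le h (omega1_le_ord hκ)) hκ ⟨Equiv.refl _⟩ h

/-- The N in C with N ∩ κ ∈ `S` are stationary above each stationary subset of A, by lifting. The
extension lemma applies to them, with SRP used at the cardinality of H_{κ⁺}. -/
theorem StationaryAbove.spanningAbove (hSRP : SRP.{u}) {κ : Cardinal.{u}} (hκ : ℵ_ 2 ≤ κ)
    {S : Set (Set Ordinal.{u})} {A : Set Omega1.{u}} (h : StationaryAbove κ S A) :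
    SpanningAbove κ S A := by
  intro C hC
  have hκ1 : ω_ 1 ≤ κ.ord := omega1_le_ord hκ
  have hX : ∀ ξ < ω_ 1, ξ.toZFSet ∈ H (Order.succ κ) := fun ξ hξ =>
    toZFSet_mem_H ξ (lt_of_lt_of_le hξ hκ1)
  obtain ⟨F, hF, hFC⟩ :=
    IsClubIn.exists_closedUnder (d := Ordinal.toZFSet) Ordinal.toZFSet_injective hX hC
  obtain ⟨lam, hlam, hcard⟩ := exists_equiv_H ((Cardinal.aleph0_le_aleph 2).trans hκ)
  obtain ⟨D, hD, hDC⟩ := hSRP.exists_extension (d := Ordinal.toZFSet) (X := H (Order.succ κ))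
    Ordinal.toZFSet_injective hX (hκ.trans hlam) hcard
    (G := {N ∈ C | ordinalsOf N ∩ Iio κ.ord ∈ S}) (A := A) fun B hBA hB => by
      refine ((isStationaryIn_lift Ordinal.toZFSet_injective hκ1 toZFSet_mem_H
        (h B hBA hB)).inter_closedUnder Ordinal.toZFSet_injective hX hF).mono ?_ ?_
      · rintro N ⟨⟨hN, hNS, hNB⟩, hNF⟩
        exact ⟨⟨hFC N hN hNF, hNS⟩, (deltaMem_inter_iff hκ1).1 hNB⟩
      · rintro N hN
        exact hC.subset hN.1.1
  refine ⟨D, hD, fun M hM hMA => ?_⟩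
  obtain ⟨N, hN, hMN, htr⟩ := hDC M hM hMA
  exact ⟨N, hN.1, ⟨hMN, htr⟩, hN.2⟩

theorem StationaryAbove.modelExt (hSRP : SRP.{u}) {κ μ : Cardinal.{u}} (hκ : ℵ_ 2 ≤ κ)
    (hμ : κ ≤ μ) {S : Set (Set Ordinal.{u})} {A : Set Omega1.{u}} (h : StationaryAbove κ S A) :
    ModelExt.{u, v, w} κ μ S A := by
  intro L _ _
  have hκ1 : ω_ 1 ≤ κ.ord := omega1_le_ord hκ
  have hκμ : ∀ ξ < κ.ord, id ξ ∈ Iio μ.ord := fun ξ hξ =>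
    lt_of_lt_of_le hξ (Cardinal.ord_le_ord.2 hμ)
  have hX : ∀ ξ < (ω_ 1 : Ordinal.{u}), id ξ ∈ Iio μ.ord := fun ξ hξ =>
    hκμ ξ (lt_of_lt_of_le hξ hκ1)
  have : Nonempty (Iio μ.ord) := ⟨⟨0, hX 0 omega1_pos⟩⟩
  obtain ⟨F, hF, hFL⟩ := exists_closedUnder_isElemSubmodel L (E := Iio μ.ord)
  obtain ⟨D, hD, hDC⟩ := hSRP.exists_extension (d := id) (X := Iio μ.ord)
    Function.injective_id hX (hκ.trans hμ) ⟨Equiv.refl _⟩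
    (G := {N ∈ Pω μ | IsElemSubmodel L (E := Iio μ.ord) N ∧ N ∩ Iio κ.ord ∈ S}) (A := A)
    fun B hBA hB => by
      refine ((isStationaryIn_lift Function.injective_id hκ1 hκμ
        (h B hBA hB)).inter_closedUnder Function.injective_id hX hF).mono ?_ ?_
      · rintro N ⟨⟨hN, hNS, hNB⟩, hNF⟩
        exact ⟨⟨hN, hFL N hN.1 hNF, hNS⟩, (deltaMem_inter_iff hκ1).1 hNB⟩
      · rintro N hN
        exact hN.1.1
  refine ⟨D, hD, fun M hM _ hMA => ?_⟩
  obtain ⟨N, hN, hMN, htr⟩ := hDC M hM hMA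
  exact ⟨N, hN.1, hN.2.1, ⟨hMN, htr⟩, hN.2.2⟩

theorem almostAllDeltaMem_of_nonstationaryAbove {κ : Cardinal.{u}} (hκ : ω_ 1 ≤ κ.ord)
    {S : Set (Set Ordinal.{u})} (hS : S ⊆ Pω κ) {A : Set Omega1.{u}}
    (h : NonstationaryAbove κ S Aᶜ) : AlmostAllDeltaMem κ S A := by
  have hX : ∀ ξ < (ω_ 1 : Ordinal.{u}), id ξ ∈ Iio κ.ord := fun ξ hξ => lt_of_lt_of_le hξ hκ
  obtain ⟨F, hF, hFS⟩ := exists_of_not_isStationaryIn (d := id) Function.injective_id hX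
    ((sep_subset _ _).trans hS) h
  refine ⟨_, isClubIn_closedUnder (d := id) Function.injective_id hX hF, fun x hx hxS => ?_⟩
  obtain ⟨δ, hδ⟩ := hx.1.2.2.exists_isDelta
  refine hδ.deltaMem_iff.2 (by_contra fun hc => hFS x ⟨hxS, δ, hc, hδ⟩ hx.2)

end StationaryStructure

/-! ### The structure theorem -/

theorem theorem6p5 (hSRP : StationaryStructure.SRP.{u}) (κ : Cardinal.{u}) (hκ : ℵ_ 2 ≤ κ) :
    (∀ S : Set (Set Ordinal.{u}),
      StationaryStructure.IsStationaryIn (StationaryStructure.Pω κ) S →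
        ∃ A : Set (Iio (ω_ 1 : Ordinal.{u})), IsStationary A ∧
          StationaryStructure.AlmostAllDeltaMem κ S A ∧
          StationaryStructure.AlmostAllExt κ S A ∧
          StationaryStructure.SpanningAbove κ S A ∧
          StationaryStructure.NonstationaryAbove κ S Aᶜ ∧
          (∀ μ : Cardinal.{u}, κ ≤ μ → StationaryStructure.ModelExt.{u, v, w} κ μ S A) ∧
          (∀ A' : Set (Iio (ω_ 1 : Ordinal.{u})),
            StationaryStructure.IsStructureSet.{u, v, w} κ S A' →
              StationaryStructure.EquivModClub A A')) ∧
    (∀ S₁ S₂ : Set (Set Ordinal.{u}),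
      StationaryStructure.IsStationaryIn (StationaryStructure.Pω κ) S₁ →
      StationaryStructure.IsStationaryIn (StationaryStructure.Pω κ) S₂ →
      StationaryStructure.EquivIn (StationaryStructure.Pω κ) S₁ S₂ →
        ∀ A₁ A₂ : Set (Iio (ω_ 1 : Ordinal.{u})),
          StationaryStructure.IsStructureSet.{u, v, w} κ S₁ A₁ →
          StationaryStructure.IsStructureSet.{u, v, w} κ S₂ A₂ →
            StationaryStructure.EquivModClub A₁ A₂) := by
  have hκ1 : ω_ 1 ≤ κ.ord := StationaryStructure.omega1_le_ord hκ
  refine ⟨fun S hS => ?_, fun S₁ S₂ _ _ h A₁ A₂ h₁ h₂ => h₁.equivModClub hκ1 h h₂⟩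
  obtain ⟨A, hA, hAc, hSA⟩ := hSRP.exists_isStationary (d := id) (X := Iio κ.ord)
    Function.injective_id (fun _ h => lt_of_lt_of_le h hκ1) hS
  have hst : StationaryStructure.StationaryAbove κ S A := hSA
  have hall : StationaryStructure.AlmostAllDeltaMem κ S A :=
    StationaryStructure.almostAllDeltaMem_of_nonstationaryAbove hκ1 hS.1 hAc
  have hspan := hst.spanningAbove hSRP hκ
  exact ⟨A, hA, hall, hst.almostAllExt hSRP hκ, hspan, hAc,
    fun μ hμ => hst.modelExt hSRP hκ hμ,
    fun A' hA' => StationaryStructure.IsStructureSet.equivModClub hκ1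
      (StationaryStructure.equivIn_refl hκ1 S) ⟨hA, hall, Or.inl hspan⟩ hA'⟩
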